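/- Let $k\ge 1$ be an integer. **Structures.** In this statement, a structure $\mathbf A$ in a language $L$ of relation and function symbols has a vertex set $A$, a relation $R_{\mathbf A}\subseteq A^n$ for every $n$-ary relation symbol $R$ and a set-valued function $F_{\mathbf A}\colon A^n\to\mathcal P(A)$ for every $n$-ary function symbol $F$. An embedding $f\colon\mathbf A\to\mathbf B$ is an injection $A\to B$ with $\bar x\in R_{\mathbf A}\iff f(\bar x)\in R_{\mathbf B}$ and $f(F_{\mathbf A}(\bar x))=F_{\mathbf B}(f(\bar x))$ for all symbols $R,F$ and all tuples $\bar x$; an isomorphism is a bijective embedding. Substructures are the structures for which the inclusion is an embedding, i.e. the structures induced on subsets closed under all functions. $\mathbf A$ is the free amalgamation of its substructures $\mathbf S,\mathbf T$ if $A=S\cup T$ and every tuple that contains both a vertex of $S\setminus T$ and a vertex of $T\setminus S$ is in no relation and has value $\emptyset$ under all functions; $\mathbf A$ is irreducible if it is not the free amalgamation of two proper substructures. A partial automorphism of $\mathbf A$ is an isomorphism between two substructures of $\mathbf A$. A triple $(f,g,h)$ of partial automorphisms is coherent if $\mathrm{Dom}(f)=\mathrm{Dom}(h)$, $\mathrm{Range}(f)=\mathrm{Dom}(g)$,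 $\mathrm{Range}(g)=\mathrm{Range}(h)$ and $h=g\circ f$. **The class $\mathcal D^k_d$.** A $k$-orientation is an oriented graph $\mathbf G$ (a directed graph without loops and without pairs of opposite edges) in which every vertex has out-degree at most $k$; a root is a vertex of out-degree less than $k$. For $y\in G$ let $\mathrm{roots}(y)$ be the set of all roots of $\mathbf G$ that are reachable from $y$ by a directed path (possibly of length $0$). Let $L_d$ be the language with one binary relation symbol $E$, one unary function symbol $F$, and one $n$-ary function symbol $F_n$ for every $n\ge 1$. Let $d(s(\mathbf G))$ be the $L_d$-structure on the vertex set of $\mathbf G$ in which $E$ is the edge relation, $F(x)=\{y : y \text{ is reachable from } x\}$, and $$F_n(x_1,\dots,x_n)=\{y : \mathrm{roots}(y)=\{x_1,\dots,x_n\}\}$$ if $x_1,\dots,x_n$ are distinct roots, while $F_n(x_1,\dots,x_n)=\emptyset$ otherwise. Let $\mathcal D^k_d$ be the class of all structures $d(s(\mathbf G))$, where $\mathbf G$ is a finite $k$-orientation. **Theorem.** $\mathcal D^k_d$ has irreducible structure faithful coherent EPPA. That is, for every $\mathbf A\in\mathcal D^k_d$ there are $\mathbf B\in\mathcal D^k_d$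 and an embedding $\psi\colon\mathbf A\to\mathbf B$ such that 1. every partial automorphism $f$ of $\psi(\mathbf A)$ extends to an automorphism $\hat f$ of $\mathbf B$, and these extensions can be chosen so that $\hat h=\hat g\circ\hat f$ for every coherent triple $(f,g,h)$ of partial automorphisms of $\psi(\mathbf A)$; 2. for every irreducible substructure $\mathbf C$ of $\mathbf B$ there is an automorphism $g$ of $\mathbf B$ with $g(C)\subseteq\psi(A)$. -/

import Mathlib

universe u v

namespace SetValued

/-- A structure in the language `L` on the vertex set `A`, where functions take *sets of vertices*
as values: an `n`-ary function symbol is interpreted by a map `Aⁿ → 𝒫(A)` and an `n`-ary relation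
symbol by a subset of `Aⁿ`.  (The language carries the trivial permutation group.) -/
structure Struc (L : FirstOrder.Language.{0, 0}) (A : Type u) where
  /-- the interpretation of the function symbols -/
  func : ∀ {n : ℕ}, L.Functions n → (Fin n → A) → Set A
  /-- the interpretation of the relation symbols -/
  rel : ∀ {n : ℕ}, L.Relations n → (Fin n → A) → Prop

variable {L : FirstOrder.Language.{0, 0}} {A : Type u} {B : Type v}

/-- Embeddings: injective maps which preserve and reflect all relations and satisfy
`f (F_A(x₁, …, xₙ)) = F_B(f x₁, …, f xₙ)` for every function symbol `F`. -/
structure Embed (M : Struc L A) (N : Struc L B) where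
  /-- the map on vertices -/
  toFun : A → B
  injective : Function.Injective toFun
  map_rel : ∀ {n : ℕ} (R : L.Relations n) (x : Fin n → A), M.rel R x ↔ N.rel R (toFun ∘ x)
  map_func : ∀ {n : ℕ} (F : L.Functions n) (x : Fin n → A),
    toFun '' M.func F x = N.func F (toFun ∘ x)

/-- Isomorphisms: embeddings which are bijective on vertices. -/
structure Iso (M : Struc L A) (N : Struc L B) where
  /-- the bijection on vertices -/
  toEquiv : A ≃ B
  map_rel : ∀ {n : ℕ} (R : L.Relations n) (x : Fin n → A), M.rel R x ↔ N.rel R (toEquiv ∘ x)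
  map_func : ∀ {n : ℕ} (F : L.Functions n) (x : Fin n → A),
    toEquiv '' M.func F x = N.func F (toEquiv ∘ x)

/-- Automorphisms. -/
abbrev Aut (M : Struc L A) : Type u := Iso M M

/-- A substructure of `M`, given by its vertex set, which has to be closed under all functions. -/
structure Sub (M : Struc L A) where
  /-- the vertex set -/
  verts : Set A
  closed : ∀ {n : ℕ} (F : L.Functions n) (x : Fin n → A), (∀ i, x i ∈ verts) →
    M.func F x ⊆ verts

/-- A substructure, as a structure on its own vertex set. -/
def Sub.struc {M : Struc L A} (S : Sub M) : Struc L S.verts where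
  func F x := {y | (y : A) ∈ M.func F (fun i => (x i : A))}
  rel R x := M.rel R (fun i => (x i : A))

/-- The vertex set of the smallest substructure of `M` containing the set `X`. -/
def closure (M : Struc L A) (X : Set A) : Set A :=
  ⋂ S : {S : Sub M // X ⊆ S.verts}, S.1.verts

/-- `M` is the free amalgamation of its substructures `S` and `T` (over their intersection):
`S` and `T` cover `M`, and a tuple with vertices both in `S \ T` and in `T \ S` lies in no relation
and is sent to `∅` by all functions. -/
def IsFreeAmalgamation (M : Struc L A) (S T : Sub M) : Prop :=
  S.verts ∪ T.verts = Set.univ ∧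
  ∀ (n : ℕ) (x : Fin n → A),
    (∃ i, x i ∈ S.verts \ T.verts) → (∃ j, x j ∈ T.verts \ S.verts) →
      (∀ R : L.Relations n, ¬ M.rel R x) ∧ (∀ F : L.Functions n, M.func F x = ∅)

/-- A structure is irreducible if it is not the free amalgamation of two proper substructures. -/
def IsIrreducible (M : Struc L A) : Prop :=
  ¬ ∃ S T : Sub M, S.verts ≠ Set.univ ∧ T.verts ≠ Set.univ ∧ IsFreeAmalgamation M S T

/-- A partial automorphism of `M`: an isomorphism between two substructures of `M`. -/
structure PartialAut (M : Struc L A) where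
  /-- the domain -/
  dom : Sub M
  /-- the range -/
  ran : Sub M
  /-- the isomorphism -/
  iso : Iso dom.struc ran.struc

/-- Coherent triples `(f, g, h)`: `Dom f = Dom h`, `Range f = Dom g`, `Range g = Range h` and
`h = g ∘ f`. -/
def IsCoherentTriple {M : Struc L A} (f g h : PartialAut M) : Prop :=
  f.dom.verts = h.dom.verts ∧ f.ran.verts = g.dom.verts ∧ g.ran.verts = h.ran.verts ∧
  ∀ (a : A) (hf : a ∈ f.dom.verts) (hg : (f.iso.toEquiv ⟨a, hf⟩ : A) ∈ g.dom.verts)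
    (hh : a ∈ h.dom.verts),
    (h.iso.toEquiv ⟨a, hh⟩ : A) = g.iso.toEquiv ⟨f.iso.toEquiv ⟨a, hf⟩, hg⟩

/-- The automorphism `θ` of `N` extends the partial automorphism `f` of `M`, where `M` is identified
with its image under the embedding `ψ`; i.e. `θ` extends `ψ ∘ f ∘ ψ⁻¹`. -/
def Extends {M : Struc L A} {N : Struc L B} (ψ : Embed M N) (θ : Aut N) (f : PartialAut M) : Prop :=
  ∀ a : f.dom.verts, θ.toEquiv (ψ.toFun a) = ψ.toFun (f.iso.toEquiv a)

/-- With respect to `ψ`, the structure `N` is a coherent EPPA-witness for `M`: one can choose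
for every partial automorphism of `ψ(M)` an automorphism of `N` extending it, in such a way that
coherent triples are sent to coherent triples (for everywhere defined maps, the latter says that the
third is the composition of the first two). -/
def IsCoherentEPPAWitness {M : Struc L A} {N : Struc L B} (ψ : Embed M N) : Prop :=
  ∃ φ : PartialAut M → Aut N,
    (∀ f, Extends ψ (φ f) f) ∧
    ∀ f g h, IsCoherentTriple f g h →
      ∀ b : B, (φ h).toEquiv b = (φ g).toEquiv ((φ f).toEquiv b)

/-- Every irreducible substructure of `N` is sent into `ψ(M)` by an automorphism of `N`. -/
def IsIrreducibleStructureFaithful {M : Struc L A} {N : Struc L B} (ψ : Embed M N) : Prop :=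
  ∀ C : Sub N, IsIrreducible C.struc →
    ∃ g : Aut N, ∀ c ∈ C.verts, g.toEquiv c ∈ Set.range ψ.toFun

/-- Irreducible structure faithful coherent EPPA for a class `K` of structures. -/
def HasIrreducibleStructureFaithfulCoherentEPPA
    (K : ∀ A : Type u, Struc L A → Prop) : Prop :=
  ∀ (A : Type u) (M : Struc L A), K A M →
    ∃ (B : Type u) (N : Struc L B), K B N ∧
      ∃ ψ : Embed M N, IsCoherentEPPAWitness ψ ∧ IsIrreducibleStructureFaithful ψ

end SetValued

namespace KOrientation

open SetValued

/-- The out-degree of a vertex. -/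
noncomputable def outDegree {V : Type u} (G : Digraph V) (x : V) : ℕ∞ := {y | G.Adj x y}.encard

/-- `k`-orientations: oriented graphs (no loops, no pair of opposite edges) in which every
vertex has out-degree at most `k`. -/
structure IsKOrientation {V : Type u} (k : ℕ) (G : Digraph V) : Prop where
  asymm : ∀ x y, G.Adj x y → ¬ G.Adj y x
  outDegree_le : ∀ x, outDegree G x ≤ k

/-- Roots: the vertices of out-degree less than `k`. -/
def IsRoot {V : Type u} (k : ℕ) (G : Digraph V) (x : V) : Prop := outDegree G x < k

/-- The relation symbols: a single binary symbol for the edges. -/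
inductive Rel : ℕ → Type
  | edge : Rel 2

/-- The function symbols of `L_s`: a single unary symbol. -/
inductive FunS : ℕ → Type
  | reach : FunS 1

/-- The function symbols of `L_d`: the unary symbol of `L_s`, and an `n`-ary symbol `F_n` for every
`n ≥ 1`. -/
inductive FunD : ℕ → Type
  | reach : FunD 1
  | rootClosure (n : ℕ) (hn : 1 ≤ n) : FunD n

/-- The language `L_s`. -/
def Ls : FirstOrder.Language.{0, 0} := ⟨FunS, Rel⟩

/-- The language `L_d`. -/
def Ld : FirstOrder.Language.{0, 0} := ⟨FunD, Rel⟩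

/-- The interpretation of the edge symbol. -/
def edgeRel {V : Type u} (G : Digraph V) : ∀ {n : ℕ}, Rel n → (Fin n → V) → Prop
  | _, .edge, x => G.Adj (x 0) (x 1)

/-- The set of vertices reachable from `x` by a directed path (possibly of length `0`). -/
def reachable {V : Type u} (G : Digraph V) (x : V) : Set V :=
  {y | Relation.ReflTransGen G.Adj x y}

/-- The interpretation of the function symbol of `L_s`: `F(x)` is the set of vertices reachable
from `x`. -/
def funcS {V : Type u} (G : Digraph V) : ∀ {n : ℕ}, FunS n → (Fin n → V) → Set V
  | _, .reach, x => reachable G (x 0)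

/-- The expansion `s(G)` of `G` to the language `L_s`. -/
def sStruc {V : Type u} (G : Digraph V) : Struc Ls V where
  func := funcS G
  rel := edgeRel G

/-- The set of all roots in the closure of `y` in `s(G)`. -/
def roots {V : Type u} (k : ℕ) (G : Digraph V) (y : V) : Set V :=
  {x | IsRoot k G x ∧ x ∈ closure (sStruc G) {y}}

/-- The interpretation of the function symbols of `L_d`: `F(x)` is the set of vertices reachable
from `x`, and `F_n(x₁, …, xₙ)` consists of the vertices `y` with `roots(y) = {x₁, …, xₙ}` if
`x₁, …, xₙ` are distinct roots, and is empty otherwise. -/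
def funcD {V : Type u} (k : ℕ) (G : Digraph V) : ∀ {n : ℕ}, FunD n → (Fin n → V) → Set V
  | _, .reach, x => reachable G (x 0)
  | _, .rootClosure _ _, x =>
    {y | (Function.Injective x ∧ ∀ i, IsRoot k G (x i)) ∧ roots k G y = Set.range x}

/-- The expansion `d(s(G))` of `s(G)` to the language `L_d`. -/
def dStruc {V : Type u} (k : ℕ) (G : Digraph V) : Struc Ld V where
  func := funcD k G
  rel := edgeRel G

/-- The class of all structures `d(s(G))`, where `G` is a finite `k`-orientation. -/
def ClassD (k : ℕ) (V : Type u) (M : Struc Ld V) : Prop :=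
  Finite V ∧ ∃ G : Digraph V, IsKOrientation k G ∧ M = dStruc k G

end KOrientation

/-!
A partial bijection of a finite set extends to a permutation by matching the complements of its
domain and its range through fixed enumerations; this choice is compatible with composition. The
substructures of `d(s(G))` are the successor-closed sets which contain every vertex whose nonempty
set of roots they contain, and three digraphs are built one over the other.

* The pointed copies, under all permutations of the vertices, of the subgraphs generated by a vertex
  of `G` form a `k`-orientation on which the extended partial automorphisms act. Every vertex of it
  can be moved into `G`, but `G` need not be closed under the functions `F_n`.
* Labelling the roots reachable from a vertex by weights in `ℤ/2` whose total at that vertex is `1`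
  separates `G` from the vertices with the same roots: the labels on the roots of `G` come from a
  weight with total `1` exactly on `G`. Hence the image of `G` becomes closed.
* Call a set of vertices bad if no automorphism maps it into the image `N` of `G`. As in the
  valuations of Hodkinson and Otto, each root carries, for every bad set `X` containing it, one of
  `|X| - 1` labels, and the roots reachable from a common vertex carry different labels. If any
  two roots in a set are reachable from a common vertex, all its labels differ, so by pigeonhole it
  is not bad.

An irreducible substructure is either generated by a vertex from which no root is reachable, or has
a root and any two of its roots are reachable from a common vertex, since otherwise it is the free
amalgamation of two closed subsets.
-/

namespace SetValued

section CoherentExtension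

theorem ncard_domain_eq_ncard_range {K : Type u} {R : K → K → Prop} (hR : Relator.BiUnique R) :
    {x | ∃ y, R x y}.ncard = {y | ∃ x, R x y}.ncard :=
  Set.ncard_congr (fun _ hx => hx.choose) (fun _ hx => ⟨_, hx.choose_spec⟩)
    (fun _ _ hx hy h => hR.1 hx.choose_spec (h ▸ hy.choose_spec))
    fun _ ⟨x, hx⟩ => ⟨x, ⟨_, hx⟩, hR.2 (Exists.choose_spec (⟨_, hx⟩ : ∃ y, R x y)) hx⟩

variable {K : Type u} [Finite K]

open Classical in
/-- The position of an element of `s` in a fixed enumeration of `s` (and `0` off `s`). -/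
noncomputable def rank (s : Set K) (x : K) : ℕ :=
  if h : x ∈ s then Finite.equivFin s ⟨x, h⟩ else 0

theorem rank_of_mem {s : Set K} {x : K} (h : x ∈ s) : rank s x = Finite.equivFin s ⟨x, h⟩ :=
  dif_pos h

theorem injOn_rank (s : Set K) : Set.InjOn (rank s) s := by
  intro x hx y hy h
  rw [rank_of_mem hx, rank_of_mem hy, Fin.val_inj, (Finite.equivFin s).apply_eq_iff_eq] at h
  exact congrArg Subtype.val h

theorem image_rank (s : Set K) : rank s '' s = Set.Iio s.ncard := by
  ext n
  constructor
  · rintro ⟨x, hx, rfl⟩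
    exact (rank_of_mem hx).trans_lt (Fin.is_lt _)
  · intro hn
    let x := (Finite.equivFin s).symm ⟨n, hn⟩
    exact ⟨x, x.2, (rank_of_mem x.2).trans (congrArg Fin.val (Equiv.apply_symm_apply _ _))⟩

theorem exists_rank_eq {s t : Set K} (h : s.ncard = t.ncard) {x : K} (hx : x ∈ s) :
    ∃ y ∈ t, rank t y = rank s x := by
  have hx' := Set.mem_image_of_mem (rank s) hx
  rwa [image_rank, h, ← image_rank] at hx'

/-- The partial bijection `R`, extended by the bijection between the complements of its domain and
range that respects their enumerations. -/
def RankExtension (R : K → K → Prop) (x y : K) : Prop :=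
  R x y ∨ (∀ z, ¬ R x z) ∧ (∀ z, ¬ R z y) ∧
    rank {z | ∃ w, R w z}ᶜ y = rank {z | ∃ w, R z w}ᶜ x

theorem biUnique_rankExtension {R : K → K → Prop} (hR : Relator.BiUnique R) :
    Relator.BiUnique (RankExtension R) := by
  constructor
  · rintro x y z (hx | ⟨hx, hz, hxz⟩) (hy | ⟨hy, hz', hyz⟩)
    · exact hR.1 hx hy
    · exact absurd hx (hz' x)
    · exact absurd hy (hz y)
    · exact injOn_rank _ (by simpa using hx) (by simpa using hy) (hxz.symm.trans hyz)
  · rintro x y z (hy | ⟨hx, hy, hxy⟩) (hz | ⟨hx', hz, hxz⟩)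
    · exact hR.2 hy hz
    · exact absurd hy (hx' y)
    · exact absurd hz (hx z)
    · exact injOn_rank _ (by simpa using hy) (by simpa using hz) (hxy.trans hxz.symm)

theorem exists_rankExtension {R : K → K → Prop} (hR : Relator.BiUnique R) (x : K) :
    ∃ y, RankExtension R x y := by
  by_cases hx : ∃ y, R x y
  · exact hx.imp fun _ => Or.inl
  have hcard : {x | ∃ y, R x y}ᶜ.ncard = {y | ∃ x, R x y}ᶜ.ncard := by
    rw [Set.ncard_compl, Set.ncard_compl, ncard_domain_eq_ncard_range hR]
  obtain ⟨y, hy, h⟩ := exists_rank_eq hcard (x := x) hx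
  exact ⟨y, .inr ⟨not_exists.1 hx, not_exists.1 hy, h⟩⟩

theorem RankExtension.comp {R S : K → K → Prop} (h : ∀ y, (∃ x, R x y) ↔ ∃ z, S y z) {x y z : K}
    (hxy : RankExtension R x y) (hyz : RankExtension S y z) :
    RankExtension (Relation.Comp R S) x z := by
  have hdom : {a | ∃ c, Relation.Comp R S a c} = {a | ∃ b, R a b} := by
    ext a
    exact ⟨fun ⟨_, b, hb, _⟩ => ⟨b, hb⟩,
      fun ⟨b, hb⟩ => ((h b).1 ⟨a, hb⟩).imp fun _ hc => ⟨b, hb, hc⟩⟩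
  have hran : {c | ∃ a, Relation.Comp R S a c} = {c | ∃ b, S b c} := by
    ext c
    exact ⟨fun ⟨_, b, _, hc⟩ => ⟨b, hc⟩,
      fun ⟨b, hc⟩ => ((h b).2 ⟨c, hc⟩).imp fun _ ha => ⟨b, ha, hc⟩⟩
  rw [RankExtension, hdom, hran]
  rcases hxy with hxy | ⟨hx, hy, hxy⟩ <;> rcases hyz with hyz | ⟨hy', hz, hyz⟩
  · exact .inl ⟨y, hxy, hyz⟩
  · exact absurd ((h y).1 ⟨x, hxy⟩) (not_exists.2 hy')
  · exact absurd ((h y).2 ⟨z, hyz⟩) (not_exists.2 hy)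
  · refine .inr ⟨fun c ⟨b, hb, _⟩ => hx b hb, fun a ⟨b, _, hb⟩ => hz b hb, ?_⟩
    have hmid : {b | ∃ a, R a b} = {b | ∃ c, S b c} := Set.ext h
    rw [hyz, ← hmid, hxy]

/-- A permutation extending the partial bijection `R`, chosen compatibly with composition. -/
noncomputable def extendPerm (R : K → K → Prop) (hR : Relator.BiUnique R) : Equiv.Perm K :=
  .ofBijective (fun x => (exists_rankExtension hR x).choose) <| Finite.injective_iff_bijective.1
    fun x y h => (biUnique_rankExtension hR).1 (exists_rankExtension hR x).choose_spec <| by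
      simpa only [h] using (exists_rankExtension hR y).choose_spec

theorem rankExtension_extendPerm {R : K → K → Prop} (hR : Relator.BiUnique R) (x : K) :
    RankExtension R x (extendPerm R hR x) :=
  (exists_rankExtension hR x).choose_spec

theorem extendPerm_apply {R : K → K → Prop} (hR : Relator.BiUnique R) {x y : K} (h : R x y) :
    extendPerm R hR x = y :=
  (biUnique_rankExtension hR).2 (rankExtension_extendPerm hR x) (.inl h)

theorem exists_apply_extendPerm_iff {R : K → K → Prop} (hR : Relator.BiUnique R) {y : K} :
    (∃ x, R x (extendPerm R hR y)) ↔ ∃ z, R y z := by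
  constructor
  · rintro ⟨x, hx⟩
    obtain rfl : x = y := (extendPerm R hR).injective (extendPerm_apply hR hx)
    exact ⟨_, hx⟩
  · rintro ⟨z, hz⟩
    exact ⟨y, by rwa [extendPerm_apply hR hz]⟩

theorem extendPerm_comp {R S T : K → K → Prop} (hR : Relator.BiUnique R) (hS : Relator.BiUnique S)
    (hT : Relator.BiUnique T) (hT_eq : T = Relation.Comp R S)
    (h : ∀ y, (∃ x, R x y) ↔ ∃ z, S y z) :
    extendPerm T hT = extendPerm S hS * extendPerm R hR := by
  subst hT_eq
  ext x
  exact (biUnique_rankExtension hT).2 (rankExtension_extendPerm hT x)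
    ((rankExtension_extendPerm hR x).comp h (rankExtension_extendPerm hS _))

end CoherentExtension

section MatchRel

variable {K : Type u}

/-- The partial bijection which sends `p v` to `q v` for `v ∈ D` and fixes all points outside of
`U`. -/
def matchRel {I : Type*} (U : Set K) (D : Set I) (p q : I → K) (x y : K) : Prop :=
  (x ∉ U ∧ x = y) ∨ ∃ v ∈ D, p v = x ∧ q v = y

theorem matchRel_swap {I : Type*} {U : Set K} {D : Set I} {p q : I → K} {x y : K} :
    matchRel U D p q x y ↔ matchRel U D q p y x := by
  simp only [matchRel, and_comm (a := p _ = x), eq_comm (a := x)]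
  exact or_congr_left (and_congr_left fun h => h ▸ Iff.rfl)

theorem exists_matchRel_iff {I : Type*} {U : Set K} {D : Set I} {p q : I → K} {x : K} :
    (∃ y, matchRel U D p q x y) ↔ x ∉ U ∨ x ∈ p '' D := by
  simp only [matchRel, Set.mem_image]
  aesop

theorem rightUnique_matchRel {I : Type*} {U : Set K} {D : Set I} {p : I → K} (q : I → K)
    (hp : Set.MapsTo p D U) (hp' : Set.InjOn p D) : Relator.RightUnique (matchRel U D p q) := by
  rintro x y z (⟨hx, rfl⟩ | ⟨v, hv, rfl, rfl⟩) (⟨hx', rfl⟩ | ⟨v', hv', h, rfl⟩)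
  · rfl
  · exact absurd (h ▸ hp hv') hx
  · exact absurd (hp hv) hx'
  · rw [hp' hv' hv h]

theorem biUnique_matchRel {I : Type*} {U : Set K} {D : Set I} {p q : I → K}
    (hp : Set.MapsTo p D U) (hp' : Set.InjOn p D) (hq : Set.MapsTo q D U) (hq' : Set.InjOn q D) :
    Relator.BiUnique (matchRel U D p q) :=
  ⟨fun _ _ _ h h' => rightUnique_matchRel p hq hq' (matchRel_swap.1 h) (matchRel_swap.1 h'),
    rightUnique_matchRel q hp hp'⟩

theorem matchRel_comp {I J : Type*} {U : Set K} {D : Set I} (p : I → K) {q : J → K} (r : J → K)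
    {θ : I → J} (hq : Set.MapsTo q (θ '' D) U) (hq' : Set.InjOn q (θ '' D)) :
    matchRel U D p (r ∘ θ) =
      Relation.Comp (matchRel U D p (q ∘ θ)) (matchRel U (θ '' D) q r) := by
  ext x z
  constructor
  · rintro (⟨hx, rfl⟩ | ⟨v, hv, rfl, rfl⟩)
    · exact ⟨x, .inl ⟨hx, rfl⟩, .inl ⟨hx, rfl⟩⟩
    · exact ⟨q (θ v), .inr ⟨v, hv, rfl, rfl⟩, .inr ⟨θ v, ⟨v, hv, rfl⟩, rfl, rfl⟩⟩
  · rintro ⟨y, ⟨hx, rfl⟩ | ⟨v, hv, rfl, rfl⟩, hyz⟩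
    · exact hyz.imp id fun ⟨w, hw, h, _⟩ => absurd (h ▸ hq hw) hx
    · obtain rfl : r (θ v) = z := rightUnique_matchRel r hq hq'
        (.inr ⟨θ v, ⟨v, hv, rfl⟩, rfl, rfl⟩) hyz
      exact .inr ⟨v, hv, rfl, rfl⟩

end MatchRel

namespace PartialAut

variable {L : FirstOrder.Language.{0, 0}} {A : Type u} {M : Struc L A}

/-- The graph of a partial automorphism, as a relation on the vertices of the whole structure. -/
def graph (f : PartialAut M) (a b : A) : Prop :=
  ∃ ha : a ∈ f.dom.verts, (f.iso.toEquiv ⟨a, ha⟩ : A) = b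

theorem biUnique_graph (f : PartialAut M) : Relator.BiUnique f.graph := by
  constructor
  · rintro a b _ ⟨ha, rfl⟩ ⟨hb, h⟩
    exact congrArg Subtype.val (f.iso.toEquiv.injective (Subtype.ext h.symm))
  · rintro a _ _ ⟨_, rfl⟩ ⟨_, rfl⟩
    rfl

theorem exists_graph_right_iff (f : PartialAut M) (a : A) :
    (∃ b, f.graph a b) ↔ a ∈ f.dom.verts :=
  ⟨fun ⟨_, ha, _⟩ => ha, fun ha => ⟨_, ha, rfl⟩⟩

theorem exists_graph_left_iff (f : PartialAut M) (b : A) :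
    (∃ a, f.graph a b) ↔ b ∈ f.ran.verts := by
  constructor
  · rintro ⟨a, ha, rfl⟩
    exact Subtype.coe_prop _
  · intro hb
    exact ⟨f.iso.toEquiv.symm ⟨b, hb⟩, Subtype.coe_prop _, by simp⟩

end PartialAut

namespace IsCoherentTriple

variable {L : FirstOrder.Language.{0, 0}} {A : Type u} {M : Struc L A} {f g h : PartialAut M}

theorem graph_eq_comp (H : IsCoherentTriple f g h) : h.graph = Relation.Comp f.graph g.graph := by
  obtain ⟨hdom, hmid, -, happly⟩ := H
  ext a c
  constructor
  · rintro ⟨ha, rfl⟩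
    have ha' : a ∈ f.dom.verts := hdom ▸ ha
    have hb : (f.iso.toEquiv ⟨a, ha'⟩ : A) ∈ g.dom.verts := hmid ▸ Subtype.coe_prop _
    exact ⟨_, ⟨ha', rfl⟩, hb, (happly a ha' hb ha).symm⟩
  · rintro ⟨_, ⟨ha, rfl⟩, hb, rfl⟩
    exact ⟨hdom ▸ ha, happly a ha hb _⟩

theorem exists_graph_iff (H : IsCoherentTriple f g h) (b : A) :
    (∃ a, f.graph a b) ↔ ∃ c, g.graph b c := by
  rw [f.exists_graph_left_iff, g.exists_graph_right_iff, H.2.1]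

end IsCoherentTriple

end SetValued

namespace KOrientation

open SetValued Relation

variable {V : Type u} {W : Type v}

theorem closure_sStruc_singleton (G : Digraph V) (y : V) :
    SetValued.closure (sStruc G) {y} = reachable G y := by
  apply Set.Subset.antisymm
  · refine Set.iInter_subset_of_subset ⟨⟨reachable G y, ?_⟩, ?_⟩ subset_rfl
    · rintro n F x hx z hz
      cases (F : FunS n)
      exact ReflTransGen.trans (hx 0) hz
    · rintro _ rfl
      exact ReflTransGen.refl
  · rintro z hz
    refine Set.mem_iInter.2 fun S => ?_
    exact S.1.closed (n := 1) FunS.reach (fun _ => y) (fun _ => S.2 rfl) hz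

theorem mem_roots {k : ℕ} {G : Digraph V} {x y : V} :
    x ∈ roots k G y ↔ IsRoot k G x ∧ ReflTransGen G.Adj y x := by
  rw [roots, closure_sStruc_singleton]
  rfl

theorem IsRoot.mem_roots {k : ℕ} {G : Digraph V} {r : V} (h : IsRoot k G r) : r ∈ roots k G r :=
  KOrientation.mem_roots.2 ⟨h, .refl⟩

theorem roots_subset_of_reflTransGen {k : ℕ} {G : Digraph V} {x y : V}
    (h : ReflTransGen G.Adj x y) : roots k G y ⊆ roots k G x := by
  intro r hr
  rw [mem_roots] at hr ⊢
  exact ⟨hr.1, h.trans hr.2⟩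

/-- Sets of vertices that edges of `D` do not leave. -/
def IsSuccClosed (D : V → V → Prop) (S : Set V) : Prop :=
  ∀ ⦃a b⦄, a ∈ S → D a b → b ∈ S

theorem IsSuccClosed.mem_of_reflTransGen {D : V → V → Prop} {S : Set V} (hS : IsSuccClosed D S)
    {a b : V} (ha : a ∈ S) (h : ReflTransGen D a b) : b ∈ S := by
  induction h with
  | refl => exact ha
  | tail _ h ih => exact hS ih h

/-- Vertex sets of substructures of `dStruc k G`. -/
structure IsClosedSet (k : ℕ) (G : Digraph V) (S : Set V) : Prop where
  isSuccClosed : IsSuccClosed G.Adj S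
  mem_of_roots : ∀ {b}, (roots k G b).Nonempty → roots k G b ⊆ S → b ∈ S

theorem IsClosedSet.funcD_subset {k : ℕ} {G : Digraph V} {S : Set V} (hS : IsClosedSet k G S)
    {n : ℕ} (F : FunD n) (x : Fin n → V) (hx : ∀ i, x i ∈ S) : funcD k G F x ⊆ S := by
  cases F with
  | reach => exact fun y hy => hS.isSuccClosed.mem_of_reflTransGen (hx 0) hy
  | rootClosure n hn =>
    rintro y ⟨-, hy⟩
    apply hS.mem_of_roots
    · exact hy ▸ ⟨_, ⟨0, hn⟩, rfl⟩
    · exact hy ▸ Set.range_subset_iff.2 hx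

theorem isClosedSet_verts [Finite V] {k : ℕ} {G : Digraph V} (S : Sub (dStruc k G)) :
    IsClosedSet k G S.verts where
  isSuccClosed a b ha hab :=
    S.closed (n := 1) FunD.reach (fun _ => a) (fun _ => ha) (ReflTransGen.single hab)
  mem_of_roots {b} hb hbS := by
    have := hb.to_subtype
    let e := (Finite.equivFin (roots k G b)).symm
    refine S.closed (FunD.rootClosure _ Nat.card_pos) (fun i => (e i : V))
      (fun i => hbS (e i).2) ⟨⟨Subtype.val_injective.comp e.injective, fun i => (e i).2.1⟩, ?_⟩
    exact (Subtype.range_val.symm.trans (e.surjective.range_comp _).symm)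

/-- Isomorphisms onto induced subgraphs on successor-closed sets. -/
structure IsClosedEmb (G : Digraph V) (H : Digraph W) (j : V → W) : Prop where
  injective : Function.Injective j
  adj_iff : ∀ a b, H.Adj (j a) b ↔ ∃ a', G.Adj a a' ∧ j a' = b

namespace IsClosedEmb

theorem of_relIso {G : Digraph V} {H : Digraph W} (θ : G.Adj ≃r H.Adj) : IsClosedEmb G H θ where
  injective := θ.injective
  adj_iff a b := by
    obtain ⟨b, rfl⟩ := θ.surjective b
    simp [θ.map_rel_iff]

variable {G : Digraph V} {H : Digraph W} {j : V → W} (hj : IsClosedEmb G H j)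
include hj

theorem adj_map_iff (a b : V) : H.Adj (j a) (j b) ↔ G.Adj a b := by
  simp [hj.adj_iff, hj.injective.eq_iff]

theorem outDegree_eq (a : V) : outDegree H (j a) = outDegree G a := by
  have : {y | H.Adj (j a) y} = j '' {y | G.Adj a y} := Set.ext (hj.adj_iff a)
  rw [outDegree, outDegree, this, hj.injective.encard_image]

theorem isRoot_iff (k : ℕ) (a : V) : IsRoot k H (j a) ↔ IsRoot k G a := by
  rw [IsRoot, IsRoot, hj.outDegree_eq]

theorem reflTransGen_iff (a : V) (b : W) :
    ReflTransGen H.Adj (j a) b ↔ ∃ a', ReflTransGen G.Adj a a' ∧ j a' = b := by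
  constructor
  · intro h
    induction h with
    | refl => exact ⟨a, .refl, rfl⟩
    | tail _ h ih =>
      obtain ⟨a', ha', rfl⟩ := ih
      obtain ⟨a'', h', rfl⟩ := (hj.adj_iff _ _).1 h
      exact ⟨a'', ha'.tail h', rfl⟩
  · rintro ⟨a', h, rfl⟩
    exact h.lift j fun a b hab => (hj.adj_map_iff a b).2 hab

theorem reflTransGen_map_iff (a b : V) :
    ReflTransGen H.Adj (j a) (j b) ↔ ReflTransGen G.Adj a b := by
  simp [hj.reflTransGen_iff, hj.injective.eq_iff]

theorem roots_eq (k : ℕ) (a : V) : roots k H (j a) = j '' roots k G a := by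
  ext r
  simp only [Set.mem_image, mem_roots, hj.reflTransGen_iff]
  constructor
  · rintro ⟨hr, a', ha', rfl⟩
    exact ⟨a', ⟨(hj.isRoot_iff k a').1 hr, ha'⟩, rfl⟩
  · rintro ⟨a', ⟨hr, h⟩, rfl⟩
    exact ⟨(hj.isRoot_iff k a').2 hr, a', h, rfl⟩

theorem mem_roots_iff (k : ℕ) (a r : V) : j r ∈ roots k H (j a) ↔ r ∈ roots k G a := by
  rw [hj.roots_eq, hj.injective.mem_set_image]

theorem edgeRel_iff {n : ℕ} (R : Rel n) (x : Fin n → V) :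
    edgeRel G R x ↔ edgeRel H R (j ∘ x) := by
  cases R
  exact (hj.adj_map_iff _ _).symm

theorem isSuccClosed_image {S : Set V} (hS : IsSuccClosed G.Adj S) :
    IsSuccClosed H.Adj (j '' S) := by
  rintro _ b ⟨a, ha, rfl⟩ h
  obtain ⟨a', haa', rfl⟩ := (hj.adj_iff _ _).1 h
  exact ⟨a', hS ha haa', rfl⟩

theorem isSuccClosed_range : IsSuccClosed H.Adj (Set.range j) :=
  Set.image_univ ▸ hj.isSuccClosed_image fun _ _ _ _ => trivial

theorem mem_funcD_iff {k n : ℕ} (F : FunD n) (x : Fin n → V) (a : V) :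
    j a ∈ funcD k H F (j ∘ x) ↔ a ∈ funcD k G F x := by
  cases F with
  | reach => exact hj.reflTransGen_map_iff _ _
  | rootClosure n hn =>
    simp only [funcD, Set.mem_ofPred_eq, hj.roots_eq, Set.range_comp,
      hj.injective.image_injective.eq_iff, Function.comp_apply, hj.isRoot_iff,
      hj.injective.of_comp_iff]

theorem image_funcD {k : ℕ} (hr : IsClosedSet k H (Set.range j)) {n : ℕ} (F : FunD n)
    (x : Fin n → V) : j '' funcD k G F x = funcD k H F (j ∘ x) := by
  have hpre : funcD k G F x = j ⁻¹' funcD k H F (j ∘ x) :=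
    Set.ext fun a => (hj.mem_funcD_iff F x a).symm
  rw [hpre, Set.image_preimage_eq_iff]
  exact hr.funcD_subset F (j ∘ x) fun i => ⟨x i, rfl⟩

/-- A closed embedding with closed range, as an embedding of the expansions. -/
def embed {k : ℕ} (hr : IsClosedSet k H (Set.range j)) : Embed (dStruc k G) (dStruc k H) where
  toFun := j
  injective := hj.injective
  map_rel R x := hj.edgeRel_iff R x
  map_func F x := hj.image_funcD hr F x

end IsClosedEmb

/-- An automorphism of a digraph, as an automorphism of its expansion. -/
def autOfRelIso {G : Digraph V} (k : ℕ) (θ : G.Adj ≃r G.Adj) : Aut (dStruc k G) where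
  toEquiv := θ.toEquiv
  map_rel R x := (IsClosedEmb.of_relIso θ).edgeRel_iff R x
  map_func F x := (IsClosedEmb.of_relIso θ).image_funcD
    ⟨(IsClosedEmb.of_relIso θ).isSuccClosed_range, fun _ _ => θ.surjective _⟩ F x

theorem IsClosedSet.preimage {k : ℕ} {G : Digraph V} {S : Set V} (hS : IsClosedSet k G S)
    (θ : G.Adj ≃r G.Adj) : IsClosedSet k G (θ ⁻¹' S) where
  isSuccClosed _ _ ha hab := hS.isSuccClosed ha (θ.map_rel_iff.2 hab)
  mem_of_roots {b} hb hbS := by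
    apply hS.mem_of_roots <;> rw [(IsClosedEmb.of_relIso θ).roots_eq]
    · exact hb.image _
    · exact Set.image_subset_iff.2 hbS

section Copies

/-- The edges of `D` reachable from `x`. -/
def genRel (D : V → V → Prop) (x : V) : V → V → Prop := fun a b => ReflTransGen D x a ∧ D a b

/-- The relation `D` with vertices renamed by `π`. -/
def mapRel (π : Equiv.Perm V) (D : V → V → Prop) : V → V → Prop :=
  fun a b => D (π.symm a) (π.symm b)

theorem reflTransGen_genRel {D : V → V → Prop} {x y z : V} (h : ReflTransGen D x y) :
    ReflTransGen (genRel D x) y z ↔ ReflTransGen D y z := by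
  constructor
  · exact ReflTransGen.mono (fun _ _ h => h.2) _ _
  · intro hz
    induction hz with
    | refl => exact .refl
    | tail h' h'' ih => exact ih.tail ⟨h.trans h', h''⟩

theorem genRel_genRel {D : V → V → Prop} {x y : V} (h : ReflTransGen D x y) :
    genRel (genRel D x) y = genRel D y := by
  ext a b
  rw [genRel, reflTransGen_genRel h]
  exact ⟨fun h' => ⟨h'.1, h'.2.2⟩, fun h' => ⟨h'.1, h.trans h'.1, h'.2⟩⟩

theorem reflTransGen_congr {D D' : V → V → Prop} {T : Set V} (hT : IsSuccClosed D T)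
    (h : ∀ a ∈ T, ∀ b, D a b ↔ D' a b) {x y : V} (hx : x ∈ T) (hxy : ReflTransGen D x y) :
    ReflTransGen D' x y := by
  induction hxy with
  | refl => exact .refl
  | tail hxb hbc ih => exact ih.tail ((h _ (hT.mem_of_reflTransGen hx hxb) _).1 hbc)

theorem genRel_congr {D D' : V → V → Prop} {T : Set V} (hT : IsSuccClosed D T)
    (h : ∀ a ∈ T, ∀ b, D a b ↔ D' a b) {x : V} (hx : x ∈ T) : genRel D x = genRel D' x := by
  have hT' : IsSuccClosed D' T := fun a b ha hab => hT ha ((h a ha b).2 hab)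
  ext a b
  constructor
  · rintro ⟨ha, hab⟩
    exact ⟨reflTransGen_congr hT h hx ha, (h _ (hT.mem_of_reflTransGen hx ha) _).1 hab⟩
  · rintro ⟨ha, hab⟩
    exact ⟨reflTransGen_congr hT' (fun a ha b => (h a ha b).symm) hx ha,
      (h _ (hT'.mem_of_reflTransGen hx ha) _).2 hab⟩

theorem reflTransGen_mapRel (π : Equiv.Perm V) {D : V → V → Prop} {x y : V} :
    ReflTransGen (mapRel π D) x y ↔ ReflTransGen D (π.symm x) (π.symm y) := by
  constructor
  · exact fun h => h.lift π.symm fun _ _ h => h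
  · intro h
    simpa [Function.onFun] using
      h.lift (p := mapRel π D) π fun a b hab => by simpa [mapRel] using hab

theorem mapRel_genRel (π : Equiv.Perm V) (D : V → V → Prop) (x : V) :
    mapRel π (genRel D x) = genRel (mapRel π D) (π x) := by
  ext a b
  simp [mapRel, genRel, reflTransGen_mapRel]

theorem mapRel_symm_mapRel (π : Equiv.Perm V) (D : V → V → Prop) :
    mapRel π.symm (mapRel π D) = D := by
  ext a b
  simp [mapRel]

theorem mapRel_injective (π : Equiv.Perm V) : Function.Injective (mapRel π) :=
  Function.LeftInverse.injective (mapRel_symm_mapRel π)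

theorem mapRel_genRel_of_forall_iff {D : V → V → Prop} {S : Set V} (hS : IsSuccClosed D S)
    (π : Equiv.Perm V) (hπ : ∀ a ∈ S, ∀ b, D (π a) (π b) ↔ D a b) {a : V} (ha : a ∈ S) :
    mapRel π (genRel D a) = genRel D (π a) := by
  rw [mapRel_genRel]
  refine genRel_congr (T := π '' S) ?_ ?_ (Set.mem_image_of_mem π ha)
  · rintro _ b ⟨a, ha, rfl⟩ hab
    rw [mapRel, π.symm_apply_apply] at hab
    exact ⟨_, hS ha hab, π.apply_symm_apply b⟩
  · rintro _ ⟨a, ha, rfl⟩ b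
    rw [mapRel, π.symm_apply_apply, ← hπ a ha, π.apply_symm_apply]

/-- The pointed copies `(x, D)`, on the vertex set of `G`, of the subgraphs of `G` generated by a
vertex. -/
abbrev Copies (G : Digraph V) : Type u :=
  {p : V × (V → V → Prop) //
    ∃ (π : Equiv.Perm V) (a : V), p = (π a, mapRel π (genRel G.Adj a))}

namespace Copies

variable {G : Digraph V}

/-- The digraph on the pointed copies: there is an edge from `(x, D)` to `(y, D')` if `x → y` in `D`
and `D'` is generated by `y` in `D`. -/
def graph (G : Digraph V) : Digraph (Copies G) where
  Adj p q := p.1.2 p.1.1 q.1.1 ∧ q.1.2 = genRel p.1.2 q.1.1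

/-- The action of permutations of the vertices on copies. -/
def perm (π : Equiv.Perm V) : (graph G).Adj ≃r (graph G).Adj where
  toFun p := ⟨(π p.1.1, mapRel π p.1.2), by
    obtain ⟨ρ, a, h⟩ := p.2
    exact ⟨π * ρ, a, by rw [h]; rfl⟩⟩
  invFun p := ⟨(π.symm p.1.1, mapRel π.symm p.1.2), by
    obtain ⟨ρ, a, h⟩ := p.2
    exact ⟨π.symm * ρ, a, by rw [h]; rfl⟩⟩
  left_inv p := Subtype.ext (Prod.ext (π.symm_apply_apply _) (mapRel_symm_mapRel π _))
  right_inv p := Subtype.ext (Prod.ext (π.apply_symm_apply _) (mapRel_symm_mapRel π.symm _))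
  map_rel_iff' {p q} := by
    refine and_congr (by simp [mapRel]) ?_
    change mapRel π q.1.2 = genRel (mapRel π p.1.2) (π q.1.1) ↔ _
    rw [← mapRel_genRel, (mapRel_injective π).eq_iff]

theorem perm_mul (π ρ : Equiv.Perm V) : perm (G := G) (π * ρ) = perm π * perm ρ :=
  rfl

/-- The canonical copy at a vertex. -/
def of (G : Digraph V) (a : V) : Copies G := ⟨(a, genRel G.Adj a), 1, a, rfl⟩

theorem exists_eq_perm_of (p : Copies G) : ∃ π a, p = perm π (of G a) := by
  obtain ⟨π, a, h⟩ := p.2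
  exact ⟨π, a, Subtype.ext h⟩

theorem isClosedEmb_of : IsClosedEmb G (graph G) (of G) where
  injective a b h := congrArg (fun p : Copies G => p.1.1) h
  adj_iff a p := by
    constructor
    · rintro ⟨⟨-, h⟩, h'⟩
      exact ⟨p.1.1, h, Subtype.ext
        (Prod.ext rfl (h'.trans (genRel_genRel (.single h))).symm)⟩
    · rintro ⟨b, h, rfl⟩
      exact ⟨⟨.refl, h⟩, (genRel_genRel (.single h)).symm⟩

theorem perm_of {S : Set V} (hS : IsSuccClosed G.Adj S) (π : Equiv.Perm V)
    (hπ : ∀ a ∈ S, ∀ b, G.Adj (π a) (π b) ↔ G.Adj a b) {a : V} (ha : a ∈ S) :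
    perm π (of G a) = of G (π a) :=
  Subtype.ext (Prod.ext rfl (mapRel_genRel_of_forall_iff hS π hπ ha))

theorem isKOrientation {k : ℕ} (hG : IsKOrientation k G) : IsKOrientation k (graph G) where
  asymm p q hpq hqp := by
    obtain ⟨π, a, rfl⟩ := exists_eq_perm_of p
    obtain ⟨p, rfl⟩ := (perm π).surjective q
    rw [(perm π).map_rel_iff] at hpq hqp
    obtain ⟨b, h, rfl⟩ := (isClosedEmb_of.adj_iff _ _).1 hpq
    rw [isClosedEmb_of.adj_map_iff] at hqp
    exact hG.asymm _ _ h hqp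
  outDegree_le p := by
    obtain ⟨π, a, rfl⟩ := exists_eq_perm_of p
    rw [(IsClosedEmb.of_relIso (perm π)).outDegree_eq, isClosedEmb_of.outDegree_eq]
    exact hG.outDegree_le a

end Copies

end Copies

/-- A digraph `H` containing `G` to which all partial automorphisms of the expansion of `G` extend
coherently. It is not required that the expansion of `G` is a substructure of that of `H`, which
needs the range of the embedding to be closed. -/
structure Witness (k : ℕ) (G : Digraph V) (H : Digraph W) where
  emb : V → W
  isClosedEmb : IsClosedEmb G H emb
  ext : PartialAut (dStruc k G) → (H.Adj ≃r H.Adj)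
  ext_emb : ∀ {f : PartialAut (dStruc k G)} {a b : V}, f.graph a b → ext f (emb a) = emb b
  coherent : ∀ {f g h}, IsCoherentTriple f g h → ext h = ext g * ext f

theorem Witness.image_ext {k : ℕ} {G : Digraph V} {H : Digraph W} (w : Witness k G H)
    (f : PartialAut (dStruc k G)) : w.ext f '' (w.emb '' f.dom.verts) = w.emb '' f.ran.verts := by
  rw [Set.image_image]
  ext c
  simp only [Set.mem_image, ← f.exists_graph_right_iff, ← f.exists_graph_left_iff]
  constructor
  · rintro ⟨a, ⟨b, hab⟩, rfl⟩
    exact ⟨b, ⟨a, hab⟩, (w.ext_emb hab).symm⟩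
  · rintro ⟨b, ⟨a, hab⟩, rfl⟩
    exact ⟨a, ⟨b, hab⟩, w.ext_emb hab⟩

theorem adj_iff_of_graph {k : ℕ} {G : Digraph V} {f : PartialAut (dStruc k G)} {a a' b b' : V}
    (ha : f.graph a a') (hb : f.graph b b') : G.Adj a' b' ↔ G.Adj a b := by
  obtain ⟨ha, rfl⟩ := ha
  obtain ⟨hb, rfl⟩ := hb
  exact (f.iso.map_rel (n := 2) Rel.edge ![⟨a, ha⟩, ⟨b, hb⟩]).symm

theorem adj_extendPerm_iff [Finite V] {k : ℕ} {G : Digraph V} (f : PartialAut (dStruc k G))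
    {a : V} (ha : a ∈ f.dom.verts) (b : V) :
    G.Adj (extendPerm f.graph f.biUnique_graph a) (extendPerm f.graph f.biUnique_graph b) ↔
      G.Adj a b := by
  obtain ⟨a', haa'⟩ := (f.exists_graph_right_iff a).2 ha
  rw [extendPerm_apply _ haa']
  by_cases hb : b ∈ f.dom.verts
  · obtain ⟨b', hbb'⟩ := (f.exists_graph_right_iff b).2 hb
    rw [extendPerm_apply _ hbb', adj_iff_of_graph haa' hbb']
  · have ha' : a' ∈ f.ran.verts := (f.exists_graph_left_iff a').1 ⟨a, haa'⟩
    refine iff_of_false (fun h => hb ?_) fun h => hb ((isClosedSet_verts f.dom).isSuccClosed ha h)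
    rw [← f.exists_graph_right_iff, ← exists_apply_extendPerm_iff f.biUnique_graph,
      f.exists_graph_left_iff]
    exact (isClosedSet_verts f.ran).isSuccClosed ha' h

/-- The pointed copies extend all partial automorphisms. -/
noncomputable def copiesWitness [Finite V] (k : ℕ) (G : Digraph V) :
    Witness k G (Copies.graph G) where
  emb := Copies.of G
  isClosedEmb := Copies.isClosedEmb_of
  ext f := Copies.perm (extendPerm f.graph f.biUnique_graph)
  ext_emb {f a b} hab := by
    rw [Copies.perm_of (isClosedSet_verts f.dom).isSuccClosed _ (fun _ => adj_extendPerm_iff f)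
      ((f.exists_graph_right_iff a).1 ⟨b, hab⟩), extendPerm_apply _ hab]
  coherent H := by
    rw [← Copies.perm_mul, extendPerm_comp _ _ _ H.graph_eq_comp H.exists_graph_iff]

theorem exists_apply_mem_range_copiesWitness [Finite V] (k : ℕ) (G : Digraph V) (p : Copies G) :
    ∃ θ : (Copies.graph G).Adj ≃r (Copies.graph G).Adj,
      θ p ∈ Set.range (copiesWitness k G).emb := by
  obtain ⟨π, a, rfl⟩ := Copies.exists_eq_perm_of p
  exact ⟨(Copies.perm π).symm, a, by simp [copiesWitness]⟩

section Lifts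

/-- A condition on labellings of the roots reachable from a vertex. -/
structure LabelCond (k : ℕ) (H : Digraph W) (Λ : Type v) where
  Good : W → (W → Λ) → Prop
  congr : ∀ {z l l'}, (∀ r ∈ roots k H z, l r = l' r) → Good z l → Good z l'

namespace LabelCond

variable {k : ℕ} {H : Digraph W} {Λ : Type v} [Inhabited Λ] (C : LabelCond k H Λ)

/-- Vertices together with a labelling of the reachable roots, admissible at all reachable
vertices. The label `default` elsewhere makes the labelling of the reachable roots unique. -/
abbrev Lift : Type v :=
  {p : W × (W → Λ) // (∀ r ∉ roots k H p.1, p.2 r = default) ∧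
    ∀ z, ReflTransGen H.Adj p.1 z → C.Good z p.2}

variable {C}

instance [Finite W] [Finite Λ] : Finite C.Lift :=
  Subtype.finite

theorem Lift.ext_of_forall_mem_roots {p q : C.Lift} (h : p.1.1 = q.1.1)
    (h' : ∀ r ∈ roots k H p.1.1, p.1.2 r = q.1.2 r) : p = q := by
  refine Subtype.ext (Prod.ext h (funext fun r => ?_))
  by_cases hr : r ∈ roots k H p.1.1
  · exact h' r hr
  · rw [p.2.1 r hr, q.2.1 r (h ▸ hr)]

open Classical in
/-- The vertex `u` with the restriction of the labelling `l`. -/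
noncomputable def Lift.mk (u : W) (l : W → Λ)
    (hl : ∀ z, ReflTransGen H.Adj u z → C.Good z l) : C.Lift :=
  ⟨(u, fun r => if r ∈ roots k H u then l r else default), fun _ hr => if_neg hr,
    fun z hz => C.congr
      (fun _ hr => (if_pos (roots_subset_of_reflTransGen hz hr)).symm) (hl z hz)⟩

theorem Lift.mk_label {u : W} {l : W → Λ} {hl : ∀ z, ReflTransGen H.Adj u z → C.Good z l} {r : W}
    (hr : r ∈ roots k H u) : (Lift.mk (C := C) u l hl).1.2 r = l r :=
  if_pos hr

/-- The restriction of the labelling at `p` to the vertex `u`. -/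
noncomputable def Lift.restrict (p : C.Lift) (u : W) (h : ReflTransGen H.Adj p.1.1 u) : C.Lift :=
  Lift.mk u p.1.2 fun z hz => p.2.2 z (h.trans hz)

theorem Lift.restrict_label (p : C.Lift) {u r : W} {h : ReflTransGen H.Adj p.1.1 u}
    (hr : r ∈ roots k H u) : (p.restrict u h).1.2 r = p.1.2 r :=
  Lift.mk_label hr

theorem Lift.eq_restrict_iff {p q : C.Lift} {h : ReflTransGen H.Adj p.1.1 q.1.1} :
    q = p.restrict q.1.1 h ↔ ∀ r ∈ roots k H q.1.1, q.1.2 r = p.1.2 r := by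
  constructor
  · intro hq r hr
    exact (congrArg (fun q : C.Lift => q.1.2 r) hq).trans (p.restrict_label hr)
  · exact fun hq => Lift.ext_of_forall_mem_roots rfl fun r hr =>
      (hq r hr).trans (p.restrict_label hr).symm

variable (C) in
/-- The digraph on labelled vertices, in which the labels are preserved along edges. -/
def graph : Digraph C.Lift where
  Adj p q := H.Adj p.1.1 q.1.1 ∧ ∀ r ∈ roots k H q.1.1, q.1.2 r = p.1.2 r

theorem reflTransGen_restrict (p : C.Lift) {u : W} (hu : ReflTransGen H.Adj p.1.1 u) :
    ReflTransGen C.graph.Adj p (p.restrict u hu) := by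
  induction hu with
  | refl => rw [← Lift.eq_restrict_iff.2 fun _ _ => rfl]
  | @tail u v hu huv ih =>
    refine ih.tail ⟨huv, fun r hr => ?_⟩
    exact (p.restrict_label hr).trans
      (p.restrict_label (roots_subset_of_reflTransGen (.single huv) hr)).symm

theorem reflTransGen_iff {p q : C.Lift} :
    ReflTransGen C.graph.Adj p q ↔
      ReflTransGen H.Adj p.1.1 q.1.1 ∧ ∀ r ∈ roots k H q.1.1, q.1.2 r = p.1.2 r := by
  constructor
  · intro h
    induction h with
    | refl => exact ⟨.refl, fun _ _ => rfl⟩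
    | @tail q s _ h ih =>
      refine ⟨ih.1.tail h.1, fun r hr => ?_⟩
      rw [h.2 r hr, ih.2 r (roots_subset_of_reflTransGen (.single h.1) hr)]
  · rintro ⟨h, h'⟩
    rw [Lift.eq_restrict_iff.2 h']
    exact reflTransGen_restrict p h

theorem outDegree_graph (p : C.Lift) : outDegree C.graph p = outDegree H p.1.1 := by
  have himage : {u | H.Adj p.1.1 u} = (fun q : C.Lift => q.1.1) '' {q | C.graph.Adj p q} := by
    ext u
    constructor
    · intro hu
      exact ⟨p.restrict u (.single hu), ⟨hu, fun r => p.restrict_label⟩, rfl⟩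
    · rintro ⟨q, hq, rfl⟩
      exact hq.1
  rw [outDegree, outDegree, himage, Set.InjOn.encard_image]
  intro q hq q' hq' (h : q.1.1 = q'.1.1)
  refine Lift.ext_of_forall_mem_roots h fun r hr => ?_
  rw [hq.2 r hr, hq'.2 r (h ▸ hr)]

theorem isRoot_graph_iff (p : C.Lift) : IsRoot k C.graph p ↔ IsRoot k H p.1.1 := by
  rw [IsRoot, IsRoot, outDegree_graph]

theorem mem_roots_graph {p q : C.Lift} : q ∈ roots k C.graph p ↔
    q.1.1 ∈ roots k H p.1.1 ∧ ∀ r ∈ roots k H q.1.1, q.1.2 r = p.1.2 r := by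
  rw [mem_roots, mem_roots, isRoot_graph_iff, reflTransGen_iff, and_assoc]

theorem restrict_mem_roots (p : C.Lift) {r : W} (hr : r ∈ roots k H p.1.1) :
    p.restrict r (mem_roots.1 hr).2 ∈ roots k C.graph p :=
  mem_roots_graph.2 ⟨hr, fun _ => p.restrict_label⟩

theorem roots_graph_nonempty_iff {p : C.Lift} :
    (roots k C.graph p).Nonempty ↔ (roots k H p.1.1).Nonempty :=
  ⟨fun ⟨_, hq⟩ => ⟨_, (mem_roots_graph.1 hq).1⟩, fun ⟨_, hr⟩ => ⟨_, restrict_mem_roots p hr⟩⟩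

theorem isKOrientation_graph (hH : IsKOrientation k H) : IsKOrientation k C.graph where
  asymm _ _ h h' := hH.asymm _ _ h.1 h'.1
  outDegree_le p := (outDegree_graph p).trans_le (hH.outDegree_le _)

variable (C) in
/-- Injections of the labels, one for each vertex `r`, by which the labels at `r` become labels at
`θ r` in an admissible way. -/
structure Relabelling (θ : H.Adj ≃r H.Adj) where
  map : W → Λ → Λ
  injective : ∀ r, Function.Injective (map r)
  good : ∀ {z l}, C.Good z l → C.Good (θ z) fun r => map (θ.symm r) (l (θ.symm r))

namespace Relabelling

variable {θ : H.Adj ≃r H.Adj} (σ : C.Relabelling θ)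

/-- The map on labelled vertices induced by a relabelling. -/
noncomputable def liftFun (p : C.Lift) : C.Lift :=
  Lift.mk (θ p.1.1) (fun r => σ.map (θ.symm r) (p.1.2 (θ.symm r))) fun z hz => by
    obtain ⟨z, hz', rfl⟩ := ((IsClosedEmb.of_relIso θ).reflTransGen_iff _ _).1 hz
    exact σ.good (p.2.2 z hz')

theorem liftFun_label (p : C.Lift) {r : W} (hr : r ∈ roots k H p.1.1) :
    (σ.liftFun p).1.2 (θ r) = σ.map r (p.1.2 r) := by
  refine (Lift.mk_label (((IsClosedEmb.of_relIso θ).mem_roots_iff k _ _).2 hr)).trans ?_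
  rw [θ.symm_apply_apply]

theorem injective_liftFun : Function.Injective σ.liftFun := by
  intro p q hpq
  have hfst : p.1.1 = q.1.1 := θ.injective (congrArg (fun p : C.Lift => p.1.1) hpq)
  refine Lift.ext_of_forall_mem_roots hfst fun r hr => σ.injective r ?_
  rw [← σ.liftFun_label p hr, ← σ.liftFun_label q (hfst ▸ hr), hpq]

variable [Finite W] [Finite Λ]

/-- The automorphism of the digraph on labelled vertices induced by a relabelling. -/
noncomputable def lift : C.graph.Adj ≃r C.graph.Adj where
  toEquiv := .ofBijective σ.liftFun (Finite.injective_iff_bijective.1 σ.injective_liftFun)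
  map_rel_iff' {p q} := by
    change H.Adj (θ p.1.1) (θ q.1.1) ∧
        (∀ r ∈ roots k H (θ q.1.1), (σ.liftFun q).1.2 r = (σ.liftFun p).1.2 r) ↔
      H.Adj p.1.1 q.1.1 ∧ ∀ r ∈ roots k H q.1.1, q.1.2 r = p.1.2 r
    rw [θ.map_rel_iff, (IsClosedEmb.of_relIso θ).roots_eq, Set.forall_mem_image]
    refine and_congr_right fun h => forall₂_congr fun r hr => ?_
    rw [σ.liftFun_label q hr, σ.liftFun_label p (roots_subset_of_reflTransGen (.single h) hr),
      (σ.injective r).eq_iff]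

theorem lift_fst (p : C.Lift) : (σ.lift p).1.1 = θ p.1.1 :=
  rfl

theorem lift_label (p : C.Lift) {r : W} (hr : r ∈ roots k H p.1.1) :
    (σ.lift p).1.2 (θ r) = σ.map r (p.1.2 r) :=
  σ.liftFun_label p hr

theorem lift_eq_iff {p q : C.Lift} : σ.lift p = q ↔
    θ p.1.1 = q.1.1 ∧ ∀ r ∈ roots k H p.1.1, σ.map r (p.1.2 r) = q.1.2 (θ r) := by
  constructor
  · rintro rfl
    exact ⟨rfl, fun r hr => (σ.lift_label p hr).symm⟩
  · rintro ⟨hfst, hlabel⟩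
    refine Lift.ext_of_forall_mem_roots hfst ?_
    rw [lift_fst, (IsClosedEmb.of_relIso θ).roots_eq, Set.forall_mem_image]
    exact fun r hr => (σ.lift_label p hr).trans (hlabel r hr)

theorem lift_eq_mul {θ₁ θ₂ : H.Adj ≃r H.Adj} {σ : C.Relabelling θ} {σ₁ : C.Relabelling θ₁}
    {σ₂ : C.Relabelling θ₂} (hθ : θ = θ₂ * θ₁)
    (hσ : ∀ r x, σ.map r x = σ₂.map (θ₁ r) (σ₁.map r x)) : σ.lift = σ₂.lift * σ₁.lift := by
  subst hθ
  ext1 p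
  refine σ.lift_eq_iff.2 ⟨rfl, fun r hr => ?_⟩
  have hr' : θ₁ r ∈ roots k H (σ₁.lift p).1.1 :=
    ((IsClosedEmb.of_relIso θ₁).mem_roots_iff k _ _).2 hr
  rw [hσ, ← σ₁.lift_label p hr, ← σ₂.lift_label _ hr']
  rfl

end Relabelling

section LiftSection

variable {G : Digraph V} {j : V → W} (hj : IsClosedEmb G H j)
  {l : W → Λ} (hl : ∀ a, C.Good (j a) l)

/-- The lift of an embedding by means of a labelling of all vertices. -/
noncomputable def liftSection (a : V) : C.Lift :=
  Lift.mk (j a) l fun z hz => by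
    obtain ⟨b, -, rfl⟩ := (hj.reflTransGen_iff a z).1 hz
    exact hl b

theorem liftSection_label {a : V} {r : W} (hr : r ∈ roots k H (j a)) :
    (liftSection hj hl a).1.2 r = l r :=
  Lift.mk_label hr

theorem eq_liftSection_iff {p : C.Lift} {a : V} : p = liftSection hj hl a ↔
    p.1.1 = j a ∧ ∀ r ∈ roots k H p.1.1, p.1.2 r = l r := by
  constructor
  · rintro rfl
    exact ⟨rfl, fun r => liftSection_label hj hl⟩
  · rintro ⟨ha, h⟩
    exact Lift.ext_of_forall_mem_roots ha fun r hr =>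
      (h r hr).trans (liftSection_label hj hl (ha ▸ hr)).symm

theorem mem_range_liftSection {p : C.Lift} : p ∈ Set.range (liftSection hj hl) ↔
    p.1.1 ∈ Set.range j ∧ ∀ r ∈ roots k H p.1.1, p.1.2 r = l r := by
  simp only [Set.mem_range, eq_comm (b := p), eq_liftSection_iff, exists_and_right,
    eq_comm (a := p.1.1)]

theorem isClosedEmb_liftSection : IsClosedEmb G C.graph (liftSection hj hl) where
  injective a b h := hj.injective (congrArg (fun p : C.Lift => p.1.1) h)
  adj_iff a p := by
    constructor
    · rintro ⟨h, h'⟩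
      obtain ⟨b, hab, hb⟩ := (hj.adj_iff _ _).1 h
      refine ⟨b, hab, ((eq_liftSection_iff hj hl).2 ⟨hb.symm, fun r hr => ?_⟩).symm⟩
      rw [h' r hr, liftSection_label hj hl (roots_subset_of_reflTransGen (.single h) hr)]
    · rintro ⟨b, hab, rfl⟩
      have h : H.Adj (j a) (j b) := (hj.adj_map_iff _ _).2 hab
      refine ⟨h, fun r hr => ?_⟩
      rw [liftSection_label hj hl hr,
        liftSection_label hj hl (roots_subset_of_reflTransGen (.single h) hr)]

theorem isClosedSet_range_liftSection (h : ∀ u, (roots k H u).Nonempty →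
    roots k H u ⊆ Set.range j → C.Good u l → u ∈ Set.range j) :
    IsClosedSet k C.graph (Set.range (liftSection hj hl)) where
  isSuccClosed := (isClosedEmb_liftSection hj hl).isSuccClosed_range
  mem_of_roots {p} hp hpr := by
    have hroots : ∀ r ∈ roots k H p.1.1, r ∈ Set.range j ∧ p.1.2 r = l r := by
      intro r hr
      obtain ⟨hrj, hrl⟩ := (mem_range_liftSection hj hl).1 (hpr (restrict_mem_roots p hr))
      have hr_self : r ∈ roots k H r := (mem_roots.1 hr).1.mem_roots
      exact ⟨hrj, (p.restrict_label hr_self).symm.trans (hrl r hr_self)⟩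
    refine (mem_range_liftSection hj hl).2 ⟨?_, fun r hr => (hroots r hr).2⟩
    exact h _ (roots_graph_nonempty_iff.1 hp) (fun r hr => (hroots r hr).1)
      (C.congr (fun r hr => (hroots r hr).2) (p.2.2 _ .refl))

theorem lift_mem_range_liftSection [Finite W] [Finite Λ] {θ : H.Adj ≃r H.Adj}
    (σ : C.Relabelling θ) {p : C.Lift} (hp : θ p.1.1 ∈ Set.range j)
    (h : ∀ r ∈ roots k H p.1.1, σ.map r (p.1.2 r) = l (θ r)) :
    σ.lift p ∈ Set.range (liftSection hj hl) := by
  refine (mem_range_liftSection hj hl).2 ⟨hp, ?_⟩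
  rw [σ.lift_fst, (IsClosedEmb.of_relIso θ).roots_eq, Set.forall_mem_image]
  exact fun r hr => (σ.lift_label p hr).trans (h r hr)

end LiftSection

/-- The lift of a witness by means of a coherent family of relabellings. -/
noncomputable def liftWitness [Finite V] [Finite W] [Finite Λ] {G : Digraph V} (w : Witness k G H)
    {l : W → Λ} (hl : ∀ a, C.Good (w.emb a) l)
    (σ : ∀ f : PartialAut (dStruc k G), C.Relabelling (w.ext f))
    (hσl : ∀ {f : PartialAut (dStruc k G)} {a b},
      f.graph a b → (σ f).map (w.emb a) (l (w.emb a)) = l (w.emb b))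
    (hσ : ∀ {f g h}, IsCoherentTriple f g h →
      ∀ r x, (σ h).map r x = (σ g).map (w.ext f r) ((σ f).map r x)) :
    Witness k G C.graph where
  emb := liftSection w.isClosedEmb hl
  isClosedEmb := isClosedEmb_liftSection w.isClosedEmb hl
  ext f := (σ f).lift
  ext_emb {f a b} hab := by
    refine (eq_liftSection_iff w.isClosedEmb hl).2 ⟨w.ext_emb hab, ?_⟩
    rw [Relabelling.lift_fst, (IsClosedEmb.of_relIso (w.ext f)).roots_eq, Set.forall_mem_image]
    intro r hr
    rw [(σ f).lift_label _ hr, liftSection_label w.isClosedEmb hl hr]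
    obtain ⟨c, hac, rfl⟩ := (w.isClosedEmb.reflTransGen_iff _ _).1 (mem_roots.1 hr).2
    have hc : c ∈ f.dom.verts := (isClosedSet_verts f.dom).isSuccClosed.mem_of_reflTransGen
      ((f.exists_graph_right_iff a).1 ⟨b, hab⟩) hac
    obtain ⟨d, hcd⟩ := (f.exists_graph_right_iff c).2 hc
    rw [w.ext_emb hcd, hσl hcd]
  coherent h := Relabelling.lift_eq_mul (w.coherent h) (hσ h)

end LabelCond

end Lifts

section Parity

variable {k : ℕ} {H : Digraph W}

/-- The total weight of `z` at the roots reachable from `z`. -/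
noncomputable def total (k : ℕ) (H : Digraph W) (m : W → W → ZMod 2) (z : W) : ZMod 2 :=
  ∑ᶠ r ∈ roots k H z, m r z

theorem total_congr {m m' : W → W → ZMod 2} {z : W} (h : ∀ r ∈ roots k H z, m r z = m' r z) :
    total k H m z = total k H m' z :=
  finsum_mem_congr rfl h

theorem total_eq_zero {z : W} (h : roots k H z = ∅) (m : W → W → ZMod 2) : total k H m z = 0 := by
  rw [total, h, finsum_mem_empty]

theorem total_apply (θ : H.Adj ≃r H.Adj) (m : W → W → ZMod 2) (z : W) :
    total k H m (θ z) = total k H (fun r z => m (θ r) (θ z)) z := by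
  rw [total, (IsClosedEmb.of_relIso θ).roots_eq, finsum_mem_image θ.injective.injOn, total]

theorem exists_eqOn_finsum_mem_eq {A : Type*} [AddCommGroup A] [Finite W] {X S : Set W}
    (h : ¬ X ⊆ S) (m : W → A) (c : A) : ∃ m', Set.EqOn m' m S ∧ ∑ᶠ r ∈ X, m' r = c := by
  classical
  obtain ⟨r, hrX, hrS⟩ := Set.not_subset.1 h
  have hsum (d : A) : ∑ᶠ s ∈ X, Function.update m r d s = d + ∑ᶠ s ∈ X \ {r}, m s := by
    conv_lhs => rw [← Set.insert_sdiff_self_of_mem hrX]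
    rw [finsum_mem_insert _ (by simp) (Set.toFinite _), Function.update_self]
    exact congrArg (d + ·) (finsum_mem_congr rfl fun s hs => Function.update_of_ne hs.2 d m)
  refine ⟨Function.update m r (c - ∑ᶠ s ∈ X \ {r}, m s), fun s hs => ?_, ?_⟩
  · exact Function.update_of_ne (ne_of_mem_of_not_mem hs hrS) _ m
  · rw [hsum, sub_add_cancel]

theorem exists_eqOn_total_eq [Finite W] (k : ℕ) (H : Digraph W) (S : Set W) (m : W → W → ZMod 2)
    (c : W → ZMod 2) :
    ∃ m', Set.EqOn m' m S ∧ ∀ z, ¬ roots k H z ⊆ S → total k H m' z = c z := by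
  have hz (z : W) : ∃ n : W → ZMod 2, Set.EqOn n (fun r => m r z) S ∧
      (¬ roots k H z ⊆ S → ∑ᶠ r ∈ roots k H z, n r = c z) := by
    by_cases h : roots k H z ⊆ S
    · exact ⟨_, Set.eqOn_refl _ S, (absurd h ·)⟩
    · exact (exists_eqOn_finsum_mem_eq h _ (c z)).imp fun _ hn => ⟨hn.1, fun _ => hn.2⟩
  choose n hnS hn using hz
  exact ⟨fun r z => n z r, fun r hr => funext fun z => hnS z hr, hn⟩

/-- A weight detects `P` if a vertex has total weight `1` in `P` and total weight `0` outside of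
`P`, apart from vertices without reachable roots, which always have total weight `0`. -/
def Detects (k : ℕ) (H : Digraph W) (P : Set W) (m : W → W → ZMod 2) : Prop :=
  ∀ z, (roots k H z).Nonempty → total k H m z = P.indicator 1 z

theorem exists_detects [Finite W] (k : ℕ) (H : Digraph W) (P : Set W) : ∃ m, Detects k H P m := by
  obtain ⟨m, -, hm⟩ := exists_eqOn_total_eq k H ∅ 0 (P.indicator 1)
  exact ⟨m, fun z hz => hm z fun h => hz.ne_empty (Set.subset_empty_iff.1 h)⟩

theorem Detects.exists_eqOn [Finite W] {P Q : Set W} {m : W → W → ZMod 2} (hm : Detects k H Q m)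
    (hP : IsSuccClosed H.Adj P)
    (hPQ : ∀ z, (roots k H z).Nonempty → roots k H z ⊆ P → (z ∈ Q ↔ z ∈ P)) :
    ∃ m', Set.EqOn m' m P ∧ Detects k H P m' := by
  classical
  obtain ⟨m', hm', htotal⟩ := exists_eqOn_total_eq k H P m 0
  refine ⟨m', hm', fun z hz => ?_⟩
  by_cases hzP : roots k H z ⊆ P
  · rw [total_congr fun r hr => congrFun (hm' (hzP hr)) z, hm z hz]
    simp only [Set.indicator_apply, hPQ z hz hzP]
  · have hz' : z ∉ P := fun hz' =>
      hzP fun r hr => hP.mem_of_reflTransGen hz' (mem_roots.1 hr).2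
    rw [htotal z hzP, Set.indicator_of_notMem hz', Pi.zero_apply]

theorem Detects.total_image {P : Set W} {m m' : W → W → ZMod 2} (hm : Detects k H P m)
    {θ : H.Adj ≃r H.Adj} (hm' : Detects k H (θ '' P) m') (z : W) :
    total k H m' (θ z) = total k H m z := by
  have hroots := (IsClosedEmb.of_relIso θ).roots_eq k z
  obtain hz | hz := (roots k H z).eq_empty_or_nonempty
  · rw [total_eq_zero hz, total_eq_zero (hroots.trans (by rw [hz, Set.image_empty]))]
  · rw [hm z hz, hm' _ (hroots ▸ hz.image θ)]
    classical simp only [Set.indicator_apply, θ.injective.mem_set_image, Pi.one_apply]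

/-- Labels are weights, which have to be of total weight `1`. -/
noncomputable def parityCond (k : ℕ) (H : Digraph W) : LabelCond k H (W → ZMod 2) where
  Good z m := (roots k H z).Nonempty → total k H m z = 1
  congr h hg hz := (total_congr fun r hr => congrFun (h r hr).symm _).trans (hg hz)

theorem total_add [Finite W] (m m' : W → W → ZMod 2) (z : W) :
    total k H (m + m') z = total k H m z + total k H m' z :=
  finsum_mem_add_distrib (Set.toFinite _)

/-- The relabelling along `θ` which shifts by two weights. -/
def shift [Finite W] (θ : H.Adj ≃r H.Adj) (m m' : W → W → ZMod 2)
    (h : ∀ z, total k H m' (θ z) = total k H m z) : (parityCond k H).Relabelling θ where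
  map r x z := x (θ.symm z) + m r (θ.symm z) + m' (θ r) z
  injective r x y hxy := funext fun z => by simpa using congrFun hxy (θ z)
  good {z l} hl hz := by
    rw [(IsClosedEmb.of_relIso θ).roots_eq] at hz
    have htotal : total k H (l + m + fun r z => m' (θ r) (θ z)) z = 1 := by
      rw [total_add, total_add, ← total_apply, h, hl hz.of_image, add_assoc,
        CharTwo.add_self_eq_zero, add_zero]
    simp only [total_apply, θ.symm_apply_apply]
    exact htotal

theorem shift_map_mul [Finite W] {θ₁ θ₂ θ : H.Adj ≃r H.Adj} (hθ : θ = θ₂ * θ₁)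
    {m₁ m₂ m₃ : W → W → ZMod 2} {h₁ : ∀ z, total k H m₂ (θ₁ z) = total k H m₁ z}
    {h₂ : ∀ z, total k H m₃ (θ₂ z) = total k H m₂ z}
    {h : ∀ z, total k H m₃ (θ z) = total k H m₁ z} (r : W) (x : W → ZMod 2) :
    (shift θ m₁ m₃ h).map r x =
      (shift θ₂ m₂ m₃ h₂).map (θ₁ r) ((shift θ₁ m₁ m₂ h₁).map r x) := by
  subst hθ
  funext z
  change x (θ₁.symm (θ₂.symm z)) + m₁ r (θ₁.symm (θ₂.symm z)) + m₃ (θ₂ (θ₁ r)) z =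
    x (θ₁.symm (θ₂.symm z)) + m₁ r (θ₁.symm (θ₂.symm z)) + m₂ (θ₁ r) (θ₂.symm z) +
      m₂ (θ₁ r) (θ₂.symm z) + m₃ (θ₂ (θ₁ r)) z
  rw [CharTwo.add_cancel_right]

/-- Every vertex without reachable roots is sent to the image of the embedding by an
automorphism. -/
def Witness.RootlessFaithful {G : Digraph V} (w : Witness k G H) : Prop :=
  ∀ b, roots k H b = ∅ → ∃ θ : H.Adj ≃r H.Adj, θ b ∈ Set.range w.emb

theorem LabelCond.rootlessFaithful_liftWitness [Finite V] [Finite W] {Λ : Type v} [Finite Λ]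
    [Inhabited Λ] {C : LabelCond k H Λ} {G : Digraph V} {w : Witness k G H}
    (hw : w.RootlessFaithful) (σ : ∀ θ : H.Adj ≃r H.Adj, C.Relabelling θ) {l hl σ' hσl hσ} :
    (C.liftWitness w (l := l) hl σ' hσl hσ).RootlessFaithful := by
  intro p hp
  have hp' : roots k H p.1.1 = ∅ := by
    rwa [← Set.not_nonempty_iff_eq_empty, roots_graph_nonempty_iff,
      Set.not_nonempty_iff_eq_empty] at hp
  obtain ⟨θ, hθ⟩ := hw p.1.1 hp'
  exact ⟨(σ θ).lift, lift_mem_range_liftSection w.isClosedEmb hl (σ θ) hθ (by simp [hp'])⟩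

theorem exists_coherent_weights [Finite W] {G : Digraph V} {j : V → W} (hj : IsClosedEmb G H j) :
    ∃ m, Detects k H (Set.range j) m ∧ ∃ e : Set V → W → W → ZMod 2, ∀ S, IsClosedSet k G S →
      Set.EqOn (e S) m (j '' S) ∧ Detects k H (j '' S) (e S) := by
  obtain ⟨m, hm⟩ := exists_detects k H (Set.range j)
  have he (S : Set V) (hS : IsClosedSet k G S) :
      ∃ m', Set.EqOn m' m (j '' S) ∧ Detects k H (j '' S) m' := by
    refine hm.exists_eqOn (hj.isSuccClosed_image hS.isSuccClosed) fun z hz hzS =>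
      ⟨?_, fun h => Set.image_subset_range j S h⟩
    rintro ⟨a, rfl⟩
    rw [hj.roots_eq] at hz hzS
    exact ⟨a, hS.mem_of_roots hz.of_image ((Set.image_subset_image_iff hj.injective).1 hzS), rfl⟩
  choose! e he using he
  exact ⟨m, hm, e, he⟩

theorem Witness.exists_isClosedSet_range [Finite V] [Finite W] {G : Digraph V}
    (w : Witness k G H) (hw : w.RootlessFaithful) :
    ∃ w' : Witness k G (parityCond k H).graph,
      IsClosedSet k (parityCond k H).graph (Set.range w'.emb) ∧ w'.RootlessFaithful := by
  obtain ⟨m, hm, e, he⟩ := exists_coherent_weights (k := k) w.isClosedEmb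
  have hl (a : V) : (parityCond k H).Good (w.emb a) m := fun h => by
    rw [hm _ h, Set.indicator_of_mem (Set.mem_range_self a), Pi.one_apply]
  have hedom (f : PartialAut (dStruc k G)) := he f.dom.verts (isClosedSet_verts f.dom)
  have heran (f : PartialAut (dStruc k G)) := he f.ran.verts (isClosedSet_verts f.ran)
  let σ (f : PartialAut (dStruc k G)) : (parityCond k H).Relabelling (w.ext f) :=
    shift (w.ext f) (e f.dom.verts) (e f.ran.verts)
      ((hedom f).2.total_image (w.image_ext f ▸ (heran f).2))
  refine ⟨LabelCond.liftWitness w hl σ ?_ ?_, ?_, LabelCond.rootlessFaithful_liftWitness hw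
    fun θ => shift θ 0 0 fun z => by simp [total]⟩
  · intro f a b hab
    funext z
    have hdom := congrFun ((hedom f).1 ⟨a, (f.exists_graph_right_iff a).1 ⟨b, hab⟩, rfl⟩)
    have hran := congrFun ((heran f).1 ⟨b, (f.exists_graph_left_iff b).1 ⟨a, hab⟩, rfl⟩) z
    change m _ _ + e f.dom.verts _ _ + e f.ran.verts (w.ext f (w.emb a)) z = _
    rw [hdom, w.ext_emb hab, hran, CharTwo.add_self_eq_zero, zero_add]
  · intro f g h H r x
    simp only [σ, ← H.1, H.2.1, ← H.2.2.1]
    exact shift_map_mul (w.coherent H) r x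
  · refine LabelCond.isClosedSet_range_liftSection w.isClosedEmb hl fun u hu _ hul => ?_
    by_contra hu'
    have := hul hu
    rw [hm _ hu, Set.indicator_of_notMem hu'] at this
    exact zero_ne_one this

end Parity

section Valuations

variable {k : ℕ} {H : Digraph W} {N P Q X : Set W}

/-- Sets of vertices that no automorphism maps into `N`. -/
def IsBad (H : Digraph W) (N X : Set W) : Prop :=
  ∀ θ : H.Adj ≃r H.Adj, ¬ θ '' X ⊆ N

theorem isBad_preimage_iff (θ : H.Adj ≃r H.Adj) : IsBad H N (θ ⁻¹' X) ↔ IsBad H N X := by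
  have himage (τ : H.Adj ≃r H.Adj) : τ '' (θ ⁻¹' X) = (τ * θ⁻¹) '' X := by
    have : θ ⁻¹' X = (θ⁻¹ : H.Adj ≃r H.Adj) '' X := (θ.toEquiv.image_symm_eq_preimage X).symm
    rw [this, Set.image_image]
    rfl
  refine ⟨fun h τ => ?_, fun h τ => himage τ ▸ h _⟩
  have := h (τ * θ)
  rwa [himage, mul_inv_cancel_right] at this

/-- The elements of the bad set `X` that lie in `P`; empty if `X` is not bad. -/
def badPart (H : Digraph W) (N P X : Set W) : Set W :=
  {r ∈ P | r ∈ X ∧ IsBad H N X}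

theorem badPart_image (θ : H.Adj ≃r H.Adj) :
    badPart H N (θ '' P) X = θ '' badPart H N P (θ ⁻¹' X) := by
  ext r
  obtain ⟨r, rfl⟩ := θ.surjective r
  simp only [badPart, θ.injective.mem_set_image, Set.mem_ofPred_eq, isBad_preimage_iff,
    Set.mem_preimage]

/-- The labels which a valuation may use on a bad set `X`: one less than `X` has elements. -/
def smallLabels (X : Set W) : Set (Fin (Nat.card W + 1)) :=
  {i | (i : ℕ) + 1 < X.ncard}

theorem last_notMem_smallLabels [Finite W] (X : Set W) : Fin.last _ ∉ smallLabels X :=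
  fun h => (h.trans_le (Set.ncard_le_card X)).not_ge (by simp)

theorem smallLabels_preimage (θ : H.Adj ≃r H.Adj) (X : Set W) :
    smallLabels (θ ⁻¹' X) = smallLabels X := by
  rw [smallLabels, smallLabels,
    Set.ncard_preimage_of_injective_subset_range θ.injective (by simp [θ.surjective.range_eq])]

/-- Labellings of the vertices in `P` by functions on all sets of vertices, which are injective on
`P ∩ X`, with few values, whenever `X` is bad. All labels that do not matter are equal. -/
structure IsValuation (H : Digraph W) (N P : Set W) (l : W → Set W → Fin (Nat.card W + 1)) :
    Prop where
  mapsTo : ∀ X, Set.MapsTo (l · X) (badPart H N P X) (smallLabels X)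
  injOn : ∀ X, Set.InjOn (l · X) (badPart H N P X)
  eq_last : ∀ X, ∀ r ∈ P, r ∉ badPart H N P X → l r X = Fin.last _

namespace IsValuation

variable {l l' c : W → Set W → Fin (Nat.card W + 1)}

theorem of_pairwise (h : ∀ r ∈ P, ∀ s ∈ P, ∃ Q m, IsValuation H N Q m ∧ r ∈ Q ∧ s ∈ Q ∧
    m r = l r ∧ m s = l s) : IsValuation H N P l where
  mapsTo X r hr := by
    obtain ⟨Q, m, hm, hrQ, -, hml, -⟩ := h r hr.1 r hr.1
    change l r X ∈ smallLabels X
    exact hml ▸ hm.mapsTo X ⟨hrQ, hr.2⟩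
  injOn X r hr s hs hrs := by
    obtain ⟨Q, m, hm, hrQ, hsQ, hmr, hms⟩ := h r hr.1 s hs.1
    exact hm.injOn X ⟨hrQ, hr.2⟩ ⟨hsQ, hs.2⟩ (by simpa [hmr, hms] using hrs)
  eq_last X r hr hrX := by
    obtain ⟨Q, m, hm, hrQ, -, hml, -⟩ := h r hr r hr
    exact congrFun hml X ▸ hm.eq_last X r hrQ fun h => hrX ⟨hr, h.2⟩

theorem congr (hl : IsValuation H N P l) (h : ∀ r ∈ P, l r = l' r) : IsValuation H N P l' :=
  of_pairwise fun r hr s hs => ⟨P, l, hl, hr, hs, h r hr, h s hs⟩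

theorem mono (hl : IsValuation H N Q l) (h : P ⊆ Q) : IsValuation H N P l :=
  of_pairwise fun _ hr _ hs => ⟨Q, l, hl, h hr, h hs, rfl, rfl⟩

theorem not_isBad [Finite W] (hl : IsValuation H N X l) : ¬ IsBad H N X := by
  intro hX
  have hbad : badPart H N X X = X := Set.sep_eq_self_iff_mem_true.2 fun _ hr => ⟨hr, hX⟩
  have hne : X.Nonempty := by
    rw [Set.nonempty_iff_ne_empty]
    rintro rfl
    exact hX (.refl _) (by simp)
  have hcard : (Set.Iio (X.ncard - 1)).ncard < X.ncard := by
    rw [Set.ncard_Iio_nat]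
    exact Nat.sub_lt (X.ncard_pos.2 hne) one_pos
  obtain ⟨r, hr, s, hs, hrs, hlrs⟩ := Set.exists_ne_map_eq_of_ncard_lt_of_maps_to hcard
    (f := fun r => (l r X : ℕ))
    fun r hr => Nat.lt_sub_of_add_lt (hl.mapsTo X (hbad.symm ▸ hr))
  exact hrs (hl.injOn X (hbad.symm ▸ hr) (hbad.symm ▸ hs) (Fin.ext hlrs))

end IsValuation

theorem rank_add_one_lt_of_isBad [Finite W] (hX : IsBad H N X) {r : W} (hr : r ∈ X ∩ N) :
    rank (X ∩ N) r + 1 < X.ncard := by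
  have hrank : rank (X ∩ N) r < (X ∩ N).ncard := by
    rw [← Set.mem_Iio, ← image_rank]
    exact Set.mem_image_of_mem _ hr
  have hXN : X ∩ N ⊂ X := Set.inter_subset_left.ssubset_of_ne fun h =>
    hX (.refl _) (by simpa using h)
  have := Set.ncard_lt_ncard hXN
  lia

theorem exists_isValuation [Finite W] (H : Digraph W) (N : Set W) : ∃ l, IsValuation H N N l := by
  classical
  let l (r : W) (X : Set W) : Fin (Nat.card W + 1) :=
    if r ∈ badPart H N N X then .ofNat _ (rank (X ∩ N) r) else .last _
  have hlt {r : W} {X : Set W} (hr : r ∈ badPart H N N X) : rank (X ∩ N) r + 1 < X.ncard :=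
    rank_add_one_lt_of_isBad hr.2.2 ⟨hr.2.1, hr.1⟩
  have hl {r : W} {X : Set W} (hr : r ∈ badPart H N N X) : (l r X : ℕ) = rank (X ∩ N) r := by
    have := (hlt hr).trans_le (Set.ncard_le_card X)
    simp only [l, if_pos hr, Fin.val_ofNat]
    exact Nat.mod_eq_of_lt (by lia)
  refine ⟨l, fun X r hr => ?_, fun X r hr s hs hrs => ?_, fun X r _ hr => if_neg hr⟩
  · exact (congrArg (· + 1) (hl hr)).trans_lt (hlt hr)
  · exact injOn_rank (X ∩ N) ⟨hr.2.1, hr.1⟩ ⟨hs.2.1, hs.1⟩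
      ((hl hr).symm.trans ((congrArg Fin.val hrs).trans (hl hs)))

/-- Labels are values of a valuation of the reachable roots. -/
def valuationCond (k : ℕ) (H : Digraph W) (N : Set W) :
    LabelCond k H (Set W → Fin (Nat.card W + 1)) where
  Good z l := IsValuation H N (roots k H z) l
  congr h hg := hg.congr h

theorem IsValuation.permute [Finite W] {l : W → Set W → Fin (Nat.card W + 1)}
    (hl : IsValuation H N P l) (θ : H.Adj ≃r H.Adj)
    {t : Set W → Equiv.Perm (Fin (Nat.card W + 1))} (ht : ∀ X, ∀ i ∉ smallLabels X, t X i = i) :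
    IsValuation H N (θ '' P) fun r X => t X (l (θ.symm r) (θ ⁻¹' X)) where
  mapsTo X := by
    rw [badPart_image, Set.mapsTo_image_iff]
    intro r hr
    by_contra h
    simp only [Function.comp_apply, θ.symm_apply_apply] at h
    have hr' : l r (θ ⁻¹' X) ∈ smallLabels (θ ⁻¹' X) := hl.mapsTo _ hr
    rw [smallLabels_preimage, ← (t X).injective (ht X _ h)] at hr'
    exact h hr'
  injOn X := by
    rw [badPart_image]
    rintro _ ⟨r, hr, rfl⟩ _ ⟨s, hs, rfl⟩ hrs
    simp only [θ.symm_apply_apply, (t X).injective.eq_iff] at hrs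
    rw [hl.injOn _ hr hs hrs]
  eq_last X := by
    rintro _ ⟨r, hr, rfl⟩ hrX
    rw [badPart_image, θ.injective.mem_set_image] at hrX
    simp only [θ.symm_apply_apply, hl.eq_last _ r hr hrX]
    exact ht X _ (last_notMem_smallLabels X)

/-- The relabelling along `θ` that permutes the labels belonging to `X` by `t X`. -/
def permute [Finite W] (k : ℕ) (N : Set W) (θ : H.Adj ≃r H.Adj)
    (t : Set W → Equiv.Perm (Fin (Nat.card W + 1))) (ht : ∀ X, ∀ i ∉ smallLabels X, t X i = i) :
    (valuationCond k H N).Relabelling θ where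
  map _ x X := t X (x (θ ⁻¹' X))
  injective _ x y hxy := funext fun X => by
    simpa [Set.preimage_image_eq X θ.injective] using congrFun hxy (θ '' X)
  good {z l} hl := by
    change IsValuation H N (roots k H (θ z)) _
    rw [(IsClosedEmb.of_relIso θ).roots_eq]
    exact hl.permute θ ht

section Transport

variable {a b c : W → Set W → Fin (Nat.card W + 1)} {θ θ₁ θ₂ : H.Adj ≃r H.Adj}

theorem IsValuation.biUnique_matchRel (ha : IsValuation H N P a) (hb : IsValuation H N (θ '' P) b)
    (X : Set W) :
    Relator.BiUnique (matchRel (smallLabels X) (badPart H N P (θ ⁻¹' X)) (a · (θ ⁻¹' X))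
      ((b · X) ∘ θ)) := by
  have hmaps := hb.mapsTo X
  have hinj := hb.injOn X
  rw [badPart_image] at hmaps hinj
  exact SetValued.biUnique_matchRel (smallLabels_preimage θ X ▸ ha.mapsTo _) (ha.injOn _)
    (Set.mapsTo_image_iff.1 hmaps) (hinj.comp θ.injective.injOn (Set.mapsTo_image θ _))

variable [Finite W]

/-- A relabelling along `θ` which takes the valuation `a` on `P` to the valuation `b` on `θ '' P`,
chosen compatibly with composition. -/
noncomputable def transport (k : ℕ) (θ : H.Adj ≃r H.Adj) (ha : IsValuation H N P a)
    (hb : IsValuation H N (θ '' P) b) : (valuationCond k H N).Relabelling θ :=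
  permute k N θ (fun X => extendPerm _ (ha.biUnique_matchRel hb X)) fun _ _ hi =>
    extendPerm_apply _ (.inl ⟨hi, rfl⟩)

theorem transport_map (ha : IsValuation H N P a) (hb : IsValuation H N (θ '' P) b) {r : W}
    (hr : r ∈ P) : (transport k θ ha hb).map r (a r) = b (θ r) := by
  funext X
  refine extendPerm_apply (ha.biUnique_matchRel hb X) ?_
  by_cases hrX : r ∈ badPart H N P (θ ⁻¹' X)
  · exact .inr ⟨r, hrX, rfl, rfl⟩
  · have hrX' : θ r ∉ badPart H N (θ '' P) X := by
      rwa [badPart_image, θ.injective.mem_set_image]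
    rw [ha.eq_last _ r hr hrX, hb.eq_last X _ (Set.mem_image_of_mem θ hr) hrX']
    exact .inl ⟨last_notMem_smallLabels X, rfl⟩

theorem transport_map_mul (hθ : θ = θ₂ * θ₁) (hPQ : Q = θ₁ '' P) (ha : IsValuation H N P a)
    (hb : IsValuation H N (θ₁ '' P) b) (hb' : IsValuation H N Q b)
    (hc : IsValuation H N (θ₂ '' Q) c) (hc' : IsValuation H N (θ '' P) c) (r : W)
    (x : Set W → Fin (Nat.card W + 1)) :
    (transport k θ ha hc').map r x =
      (transport k θ₂ hb' hc).map (θ₁ r) ((transport k θ₁ ha hb).map r x) := by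
  subst hθ hPQ
  funext X
  have hmaps := hb.mapsTo (θ₂ ⁻¹' X)
  have hinj := hb.injOn (θ₂ ⁻¹' X)
  rw [badPart_image] at hmaps hinj
  rw [smallLabels_preimage] at hmaps
  refine DFunLike.congr_fun (extendPerm_comp (ha.biUnique_matchRel hb (θ₂ ⁻¹' X))
    (hb'.biUnique_matchRel hc X) (ha.biUnique_matchRel hc' X) ?_ fun y => ?_) _
  · rw [smallLabels_preimage, badPart_image]
    exact matchRel_comp (a · (θ₁ ⁻¹' (θ₂ ⁻¹' X))) ((c · X) ∘ θ₂) hmaps hinj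
  · simp only [matchRel_swap (y := y)]
    rw [exists_matchRel_iff, exists_matchRel_iff, smallLabels_preimage, badPart_image,
      Set.image_comp]

end Transport

end Valuations

section Linked

variable {k : ℕ} {H : Digraph W}

/-- Any two elements of `X` are roots reachable from a common vertex. -/
def IsLinked (k : ℕ) (H : Digraph W) (X : Set W) : Prop :=
  ∀ p ∈ X, ∀ q ∈ X, ∃ z, p ∈ roots k H z ∧ q ∈ roots k H z

theorem IsLinked.isRoot {X : Set W} (hX : IsLinked k H X) {p : W} (hp : p ∈ X) : IsRoot k H p := by
  obtain ⟨z, hz, -⟩ := hX p hp p hp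
  exact (mem_roots.1 hz).1

theorem LabelCond.exists_labelling_of_isLinked {Λ : Type v} [Inhabited Λ] {C : LabelCond k H Λ}
    {X : Set C.Lift} (hX : ∀ p ∈ X, roots k C.graph p ⊆ X) (hX' : IsLinked k C.graph X) :
    ∃ c : W → Λ, ∀ p ∈ X, ∀ r ∈ roots k H p.1.1, p.1.2 r = c r := by
  have hinj : Function.Injective fun p : X => p.1.1.1 := by
    rintro ⟨p, hp⟩ ⟨q, hq⟩ (hpq : p.1.1 = q.1.1)
    obtain ⟨z, hpz, hqz⟩ := hX' p hp q hq
    refine Subtype.ext (Lift.ext_of_forall_mem_roots hpq fun r hr => ?_)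
    rw [(mem_roots_graph.1 hpz).2 r hr, (mem_roots_graph.1 hqz).2 r (hpq ▸ hr)]
  refine ⟨Function.extend (fun p : X => p.1.1.1) (fun p => p.1.1.2 p.1.1.1) default,
    fun p hp r hr => ?_⟩
  let q : X := ⟨p.restrict r (mem_roots.1 hr).2, hX p hp (restrict_mem_roots p hr)⟩
  have hq : q.1.1.2 r = p.1.2 r :=
    p.restrict_label (h := (mem_roots.1 hr).2) (mem_roots.1 hr).1.mem_roots
  exact hq.symm.trans (hinj.extend_apply (fun p : X => p.1.1.2 p.1.1.1) default q).symm

theorem exists_isValuation_of_isLinked {N : Set W} {X : Set (valuationCond k H N).Lift}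
    (hX : ∀ p ∈ X, roots k (valuationCond k H N).graph p ⊆ X)
    (hX' : IsLinked k (valuationCond k H N).graph X) :
    ∃ c, IsValuation H N ((fun p => p.1.1) '' X) c ∧
      ∀ p ∈ X, ∀ r ∈ roots k H p.1.1, p.1.2 r = c r := by
  obtain ⟨c, hc⟩ := LabelCond.exists_labelling_of_isLinked hX hX'
  have hlabel {p z : (valuationCond k H N).Lift} (hp : p ∈ X)
      (hz : p ∈ roots k (valuationCond k H N).graph z) : z.1.2 p.1.1 = c p.1.1 := by
    have hself : p.1.1 ∈ roots k H p.1.1 :=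
      ((LabelCond.isRoot_graph_iff p).1 (hX'.isRoot hp)).mem_roots
    rw [← (LabelCond.mem_roots_graph.1 hz).2 _ hself, hc p hp _ hself]
  refine ⟨c, .of_pairwise ?_, hc⟩
  rintro _ ⟨p, hp, rfl⟩ _ ⟨q, hq, rfl⟩
  obtain ⟨z, hpz, hqz⟩ := hX' p hp q hq
  exact ⟨roots k H z.1.1, z.1.2, z.2.2 _ .refl, (LabelCond.mem_roots_graph.1 hpz).1,
    (LabelCond.mem_roots_graph.1 hqz).1, hlabel hp hpz, hlabel hq hqz⟩

/-- Every linked set of roots which contains the roots reachable from it is sent to the image of the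
embedding by an automorphism. -/
def Witness.LinkedFaithful {G : Digraph V} (w : Witness k G H) : Prop :=
  ∀ X, (∀ p ∈ X, roots k H p ⊆ X) → IsLinked k H X →
    ∃ θ : H.Adj ≃r H.Adj, ∀ p ∈ X, θ p ∈ Set.range w.emb

theorem Witness.exists_linkedFaithful [Finite V] [Finite W] {G : Digraph V} (w : Witness k G H)
    (hw : IsClosedSet k H (Set.range w.emb)) (hw' : w.RootlessFaithful) :
    ∃ w' : Witness k G (valuationCond k H (Set.range w.emb)).graph,
      IsClosedSet k (valuationCond k H (Set.range w.emb)).graph (Set.range w'.emb) ∧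
        w'.RootlessFaithful ∧ w'.LinkedFaithful := by
  obtain ⟨l, hl⟩ := exists_isValuation H (Set.range w.emb)
  have hl_emb (a : V) : (valuationCond k H (Set.range w.emb)).Good (w.emb a) l :=
    hl.mono fun r hr => hw.isSuccClosed.mem_of_reflTransGen ⟨a, rfl⟩ (mem_roots.1 hr).2
  let σ (f : PartialAut (dStruc k G)) :
      (valuationCond k H (Set.range w.emb)).Relabelling (w.ext f) :=
    transport k (w.ext f) (hl.mono (Set.image_subset_range w.emb f.dom.verts))
      (hl.mono (w.image_ext f ▸ Set.image_subset_range w.emb f.ran.verts))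
  refine ⟨LabelCond.liftWitness w hl_emb σ ?_ ?_, ?_, LabelCond.rootlessFaithful_liftWitness hw'
    fun θ => permute k _ θ 1 fun _ _ _ => rfl, fun X hX hX' => ?_⟩
  · intro f a b hab
    rw [← w.ext_emb hab]
    exact transport_map _ _ ⟨a, (f.exists_graph_right_iff a).1 ⟨b, hab⟩, rfl⟩
  · intro f g h hfgh r x
    simp only [σ, ← hfgh.1]
    exact transport_map_mul (w.coherent hfgh) (hfgh.2.1 ▸ (w.image_ext f).symm) _ _ _ _ _ r x
  · exact LabelCond.isClosedSet_range_liftSection w.isClosedEmb hl_emb fun u hu hu' _ =>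
      hw.mem_of_roots hu hu'
  · obtain ⟨c, hc, hcX⟩ := exists_isValuation_of_isLinked hX hX'
    obtain ⟨θ, hθ⟩ := not_forall_not.1 hc.not_isBad
    refine ⟨(transport k θ hc (hl.mono hθ)).lift, fun p hp => ?_⟩
    refine LabelCond.lift_mem_range_liftSection w.isClosedEmb hl_emb _
      (hθ ⟨_, ⟨p, hp, rfl⟩, rfl⟩) fun r hr => ?_
    rw [hcX p hp r hr]
    exact transport_map hc _ ⟨_, hX p hp (LabelCond.restrict_mem_roots p hr), rfl⟩

theorem exists_faithful_witness [Finite V] {G : Digraph V} (hG : IsKOrientation k G) :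
    ∃ (W : Type u) (_ : Finite W) (H : Digraph W) (_ : IsKOrientation k H) (w : Witness k G H),
      IsClosedSet k H (Set.range w.emb) ∧ w.RootlessFaithful ∧ w.LinkedFaithful := by
  obtain ⟨w, hw⟩ := (copiesWitness k G).exists_isClosedSet_range
    fun p _ => exists_apply_mem_range_copiesWitness k G p
  obtain ⟨w', hw'⟩ := w.exists_linkedFaithful hw.1 hw.2
  exact ⟨_, inferInstance, _, LabelCond.isKOrientation_graph
    (LabelCond.isKOrientation_graph (Copies.isKOrientation hG)), w', hw'⟩

end Linked

section Irreducible

variable {k : ℕ} {H : Digraph W} {C : Sub (dStruc k H)}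

/-- The intersection of a substructure with a closed set, as a substructure of the former. -/
def IsClosedSet.sub {S : Set W} (hS : IsClosedSet k H S) (C : Sub (dStruc k H)) : Sub C.struc where
  verts := (↑) ⁻¹' S
  closed F _ hx _ hy := hS.funcD_subset F _ hx hy

theorem exists_forall_reflTransGen_of_edgeRel {n : ℕ} {R : Rel n} {x : Fin n → W}
    (hR : edgeRel H R x) : ∃ i, ∀ j, ReflTransGen H.Adj (x i) (x j) := by
  cases R
  exact ⟨0, Fin.forall_fin_two.2 ⟨.refl, .single hR⟩⟩

theorem exists_forall_reflTransGen_of_mem_funcD {n : ℕ} {F : FunD n} {x : Fin n → W} {y : W}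
    (hy : y ∈ funcD k H F x) :
    ∃ u, (u = y ∨ u ∈ Set.range x) ∧ ∀ j, ReflTransGen H.Adj u (x j) := by
  cases F with
  | reach => exact ⟨x 0, .inr ⟨0, rfl⟩, Fin.forall_fin_one.2 .refl⟩
  | rootClosure n hn =>
    exact ⟨y, .inl rfl, fun j => (mem_roots.1 (hy.2 ▸ Set.mem_range_self j)).2⟩

theorem isFreeAmalgamation_sub {S T : Set W} (hS : IsClosedSet k H S) (hT : IsClosedSet k H T)
    (hST : C.verts ⊆ S ∪ T) : IsFreeAmalgamation C.struc (hS.sub C) (hT.sub C) := by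
  refine ⟨Set.eq_univ_of_forall fun c => hST c.2, ?_⟩
  rintro n x ⟨i, -, hiT⟩ ⟨j, -, hjS⟩
  -- A tuple that is in a relation or has a nonempty value is reachable from a single vertex.
  have key (u : C.verts) (hu : ∀ i, ReflTransGen H.Adj (u : W) (x i)) : False := by
    rcases hST u.2 with huS | huT
    · exact hjS (hS.isSuccClosed.mem_of_reflTransGen huS (hu j))
    · exact hiT (hT.isSuccClosed.mem_of_reflTransGen huT (hu i))
  refine ⟨fun R hR => ?_, fun F => Set.eq_empty_iff_forall_notMem.2 fun y hy => ?_⟩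
  · obtain ⟨i, hi⟩ := exists_forall_reflTransGen_of_edgeRel hR
    exact key (x i) hi
  · obtain ⟨u, rfl | ⟨i, rfl⟩, hu⟩ := exists_forall_reflTransGen_of_mem_funcD hy
    · exact key y hu
    · exact key (x i) hu

theorem subset_or_subset_of_isIrreducible (hC : IsIrreducible C.struc) {S T : Set W}
    (hS : IsClosedSet k H S) (hT : IsClosedSet k H T) (hST : C.verts ⊆ S ∪ T) :
    C.verts ⊆ S ∨ C.verts ⊆ T := by
  by_contra! h
  have hne {S : Set W} (hS : ¬C.verts ⊆ S) : ((↑) ⁻¹' S : Set C.verts) ≠ Set.univ := fun h =>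
    hS fun c hc => Set.eq_univ_iff_forall.1 h ⟨c, hc⟩
  exact hC ⟨hS.sub C, hT.sub C, hne h.1, hne h.2, isFreeAmalgamation_sub hS hT hST⟩

theorem isClosedSet_notMem_roots (k : ℕ) (H : Digraph W) (r : W) :
    IsClosedSet k H {z | r ∉ roots k H z} where
  isSuccClosed _ _ ha hab hr := ha (roots_subset_of_reflTransGen (.single hab) hr)
  mem_of_roots _ hb hr := hb hr (mem_roots.1 hr).1.mem_roots

theorem roots_eq_empty_of_reflTransGen {a b : W} (h : ReflTransGen H.Adj a b)
    (ha : roots k H a = ∅) : roots k H b = ∅ :=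
  Set.subset_empty_iff.1 (ha ▸ roots_subset_of_reflTransGen h)

theorem isClosedSet_of_forall_roots_eq_empty {S : Set W} (hS : IsSuccClosed H.Adj S)
    (h : ∀ a ∈ S, roots k H a = ∅) : IsClosedSet k H S where
  isSuccClosed := hS
  mem_of_roots := fun ⟨r, hr⟩ hbS =>
    absurd (mem_roots.1 hr).1.mem_roots (by simp [h r (hbS hr)])

theorem isClosedSet_roots_eq_empty (k : ℕ) (H : Digraph W) :
    IsClosedSet k H {z | roots k H z = ∅} :=
  isClosedSet_of_forall_roots_eq_empty
    (fun _ _ ha hab => roots_eq_empty_of_reflTransGen (.single hab) ha) fun _ h => h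

theorem exists_generator_of_isIrreducible [Finite W] (hC : IsIrreducible C.struc)
    (hne : C.verts.Nonempty) (h : ∀ c ∈ C.verts, roots k H c = ∅) :
    ∃ c ∈ C.verts, C.verts ⊆ reachable H c := by
  obtain ⟨c, hc, hmax⟩ := C.verts.toFinite.exists_maximalFor (reachable H) _ hne
  have hS : IsClosedSet k H (reachable H c) := isClosedSet_of_forall_roots_eq_empty
    (fun _ _ ha hab => ReflTransGen.tail ha hab)
    fun _ ha => roots_eq_empty_of_reflTransGen ha (h c hc)
  have hT : IsClosedSet k H {z | roots k H z = ∅ ∧ ¬ReflTransGen H.Adj z c} :=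
    isClosedSet_of_forall_roots_eq_empty (fun _ _ ha hab =>
      ⟨roots_eq_empty_of_reflTransGen (.single hab) ha.1, fun hb => ha.2 (.head hab hb)⟩)
      fun _ ha => ha.1
  have hcover : C.verts ⊆ reachable H c ∪ {z | roots k H z = ∅ ∧ ¬ReflTransGen H.Adj z c} := by
    intro z hz
    by_cases hzc : ReflTransGen H.Adj z c
    · exact .inl (hmax hz (fun _ => hzc.trans) ReflTransGen.refl)
    · exact .inr ⟨h z hz, hzc⟩
  exact ⟨c, hc, (subset_or_subset_of_isIrreducible hC hS hT hcover).resolve_right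
    fun hCT => (hCT hc).2 .refl⟩

theorem roots_subset_verts [Finite W] (C : Sub (dStruc k H)) {c : W} (hc : c ∈ C.verts) :
    roots k H c ⊆ C.verts := fun _ hr =>
  (isClosedSet_verts C).isSuccClosed.mem_of_reflTransGen hc (mem_roots.1 hr).2

theorem isLinked_of_isIrreducible (hC : IsIrreducible C.struc) :
    IsLinked k H {r ∈ C.verts | IsRoot k H r} := by
  intro p hp q hq
  by_contra! hpq
  rcases subset_or_subset_of_isIrreducible hC (isClosedSet_notMem_roots k H p)
    (isClosedSet_notMem_roots k H q) fun z _ => or_iff_not_imp_left.2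
      fun hz => hpq z (not_not.1 hz) with h | h
  · exact h hp.1 hp.2.mem_roots
  · exact h hq.1 hq.2.mem_roots

namespace Witness

variable {G : Digraph V} {w : Witness k G H}

theorem isCoherentEPPAWitness (hr : IsClosedSet k H (Set.range w.emb)) :
    IsCoherentEPPAWitness (w.isClosedEmb.embed hr) :=
  ⟨fun f => autOfRelIso k (w.ext f), fun _ a => w.ext_emb ⟨a.2, rfl⟩,
    fun _ _ _ hfgh b => DFunLike.congr_fun (w.coherent hfgh) b⟩

variable [Finite W]

theorem RootlessFaithful.exists_map_into (hw : w.RootlessFaithful)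
    (hr : IsSuccClosed H.Adj (Set.range w.emb)) (hC : IsIrreducible C.struc)
    (h : ∀ c ∈ C.verts, roots k H c = ∅) :
    ∃ θ : H.Adj ≃r H.Adj, ∀ c ∈ C.verts, θ c ∈ Set.range w.emb := by
  obtain hCe | hne := C.verts.eq_empty_or_nonempty
  · exact ⟨.refl _, by simp [hCe]⟩
  obtain ⟨c, hc, hcC⟩ := exists_generator_of_isIrreducible hC hne h
  obtain ⟨θ, hθ⟩ := hw c (h c hc)
  exact ⟨θ, fun z hz => hr.mem_of_reflTransGen hθ
    (((IsClosedEmb.of_relIso θ).reflTransGen_map_iff c z).2 (hcC hz))⟩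

theorem LinkedFaithful.exists_map_into (hw : w.LinkedFaithful)
    (hr : IsClosedSet k H (Set.range w.emb)) (hC : IsIrreducible C.struc) {c : W}
    (hc : c ∈ C.verts) (hc' : (roots k H c).Nonempty) :
    ∃ θ : H.Adj ≃r H.Adj, ∀ c ∈ C.verts, θ c ∈ Set.range w.emb := by
  obtain ⟨θ, hθ⟩ := hw {r ∈ C.verts | IsRoot k H r}
    (fun p hp q hq => ⟨roots_subset_verts C hp.1 hq, hq.1⟩) (isLinked_of_isIrreducible hC)
  have hcover : C.verts ⊆ θ ⁻¹' Set.range w.emb ∪ {z | roots k H z = ∅} := fun z hz =>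
    (roots k H z).eq_empty_or_nonempty.symm.imp_left fun hz' =>
      (hr.preimage θ).mem_of_roots hz' fun r hr => hθ r ⟨roots_subset_verts C hz hr, hr.1⟩
  exact ⟨θ, (subset_or_subset_of_isIrreducible hC (hr.preimage θ)
    (isClosedSet_roots_eq_empty k H) hcover).resolve_right fun h => hc'.ne_empty (h hc)⟩

theorem isIrreducibleStructureFaithful (hr : IsClosedSet k H (Set.range w.emb))
    (hw : w.RootlessFaithful) (hw' : w.LinkedFaithful) :
    IsIrreducibleStructureFaithful (w.isClosedEmb.embed hr) := by
  intro C hC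
  suffices ∃ θ : H.Adj ≃r H.Adj, ∀ c ∈ C.verts, θ c ∈ Set.range w.emb from
    this.imp' (autOfRelIso k) fun _ => id
  by_cases h : ∀ c ∈ C.verts, roots k H c = ∅
  · exact hw.exists_map_into hr.isSuccClosed hC h
  · push Not at h
    obtain ⟨c, hc, hc'⟩ := h
    exact hw'.exists_map_into hr hC hc hc'

end Witness

end Irreducible

end KOrientation

theorem theorem12p8 (k : ℕ) (hk : 1 ≤ k) :
    SetValued.HasIrreducibleStructureFaithfulCoherentEPPA.{u} (L := KOrientation.Ld)
      (KOrientation.ClassD k) := by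
  rintro A M ⟨_, G, hG, rfl⟩
  obtain ⟨W, hW, H, hH, w, hr, hw, hw'⟩ := KOrientation.exists_faithful_witness hG
  exact ⟨W, KOrientation.dStruc k H, ⟨hW, H, hH, rfl⟩, w.isClosedEmb.embed hr,
    w.isCoherentEPPAWitness hr, w.isIrreducibleStructureFaithful hr hw hw'⟩
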